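/- For $x=(x_1,x_2)\in\mathbb R^2$ write $x^\perp=(-x_2,x_1)$. Let $\Omega\subset\mathbb R^2$ be open, let $p\in[1,3]$, and let $u\in W^{1/p,p}_{\mathrm{loc}}(\Omega,\mathbb R^2)$ satisfy $|u|=1$ a.e. in $\Omega$ and $\nabla\cdot u=0$ in $\mathcal D'(\Omega)$. (Here $u\in W^{1/p,p}_{\mathrm{loc}}$ means that $u\in L^p_{\mathrm{loc}}(\Omega)$ and, for $p>1$, $\int_K\int_K \frac{|u(x)-u(y)|^p}{|x-y|^{3}}\,dx\,dy<\infty$ for every compact $K\subset\Omega$, while for $p=1$ the weak derivative of $u$ lies in $L^1_{\mathrm{loc}}(\Omega)$.) Then, after modification on a null set, $u$ is locally Lipschitz continuous in $\Omega\setminus S$, where $S\subset\Omega$ is a locally finite set, i.e. every point of $\Omega$ has a neighbourhood containing only finitely many points of $S$. Moreover, every $P\in S$ is a vortex point of degree $1$ of $u$: there is a sign $\alpha\in\{1,-1\}$ such that $$u(x)=\alpha\,\frac{(x-P)^\perp}{|x-P|}$$ for every convex neighbourhood $\omega\subset\Omega$ of $P$ and every $x\in\omega$ with $x\neq P$. 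-/

import Mathlib

open MeasureTheory Topology
open scoped ContDiff

noncomputable section

/-- The Euclidean plane `ℝ²`. -/
abbrev Plane : Type := EuclideanSpace ℝ (Fin 2)

/-- The rotation `x = (x₁, x₂) ↦ x^⊥ = (-x₂, x₁)`. -/
def perp (x : Plane) : Plane := !₂[-x 1, x 0]

/-- Test functions: real-valued `C^∞` functions with compact support contained in `Ω`. -/
structure IsTestFunction (Ω : Set Plane) (φ : Plane → ℝ) : Prop where
  smooth : ContDiff ℝ ∞ φ
  compact_support : HasCompactSupport φ
  support_subset : tsupport φ ⊆ Ω

/-- `f ∈ L^p_loc(Ω)`. -/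
def MemLpLoc {F : Type*} [NormedAddCommGroup F] (p : ℝ) (Ω : Set Plane) (f : Plane → F) : Prop :=
  ∀ K : Set Plane, IsCompact K → K ⊆ Ω → MemLp f (ENNReal.ofReal p) (volume.restrict K)

/-- `G` is the weak (distributional) differential of `u` in `Ω`. -/
def IsWeakDeriv (Ω : Set Plane) (u : Plane → Plane) (G : Plane → Plane →L[ℝ] Plane) : Prop :=
  ∀ φ : Plane → ℝ, IsTestFunction Ω φ → ∀ v : Plane,
    ∫ x in Ω, fderiv ℝ φ x v • u x = -∫ x in Ω, φ x • G x v

/-- Finiteness of the local Gagliardo seminorms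
`∫_K ∫_K |u(x) - u(y)|^p / |x - y|^(2 + sp) dy dx` for all compact `K ⊆ Ω`. -/
def GagliardoFiniteLoc (s p : ℝ) (Ω : Set Plane) (u : Plane → Plane) : Prop :=
  ∀ K : Set Plane, IsCompact K → K ⊆ Ω →
    ∫⁻ x in K, ∫⁻ y in K, ENNReal.ofReal (‖u x - u y‖ ^ p / ‖x - y‖ ^ (2 + s * p)) < ⊤

/-- `u ∈ W^{s,p}_loc(Ω, ℝ²)` for an order `0 < s ≤ 1` (no function belongs for other `s`): for
`s = 1` through weak derivatives, for `0 < s < 1` through the Gagliardo seminorm. -/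
def MemSobolevLoc (s p : ℝ) (Ω : Set Plane) (u : Plane → Plane) : Prop :=
  MemLpLoc p Ω u ∧
    ((s = 1 ∧ ∃ G : Plane → Plane →L[ℝ] Plane, MemLpLoc p Ω G ∧ IsWeakDeriv Ω u G) ∨
      (0 < s ∧ s < 1 ∧ GagliardoFiniteLoc s p Ω u))

/-- `∇ · u = 0` in the sense of distributions: `∫_Ω u · ∇φ = 0` for all test functions `φ`. -/
def IsDivFree (Ω : Set Plane) (u : Plane → Plane) : Prop :=
  ∀ φ : Plane → ℝ, IsTestFunction Ω φ → ∫ x in Ω, fderiv ℝ φ x (u x) = 0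

/-- `u ∈ W^{s,p}_div(Ω, S¹)`: unit-length divergence-free fields in `W^{s,p}_loc(Ω, ℝ²)`. -/
structure MemSobolevDiv (s p : ℝ) (Ω : Set Plane) (u : Plane → Plane) : Prop where
  sobolev : MemSobolevLoc s p Ω u
  unit_length : ∀ᵐ x ∂volume.restrict Ω, ‖u x‖ = 1
  div_free : IsDivFree Ω u

end

/-!
Mollify `u` to `u_ε`. Smooth entropies of the eikonal equation are produced by `u_ε` at a rate of
at most a constant times `(1 - |u_ε|²) |∇u_ε|`. The defect `1 - |u_ε|²` is bounded by the mean
square oscillation of `u` at scale `ε`, and the gradient by its mean oscillation divided by `ε`;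
hence the product is at most the Gagliardo integrand of order `1 / p` for any `p ≤ 3`, integrated
over `|x - y| ≤ ε`, and tends to `0` in `L¹_loc`. For `p = 1` the same holds because the gradients
converge in `L¹_loc` while the defect is bounded and tends to `0` almost everywhere. In the limit
`ξ · ∇ sign (ξ · u) = 0` for every direction `ξ`: along a line in the direction `ξ`, the component
`ξ · u` does not change sign.

Between Lebesgue points `x` and `y` this sign rule reads `(u x · (y - x)) (u y · (y - x)) ≥ 0`,
and it makes the characteristics, the lines orthogonal to `u`, straight. If two characteristics
cross inside a convex subset of `Ω`, then all of them pass through the crossing point and `u` is a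
vortex around it; if none cross within a disc, then `u` is Lipschitz on a smaller one.
-/

open Filter Metric
open scoped RealInnerProductSpace

section Plane

theorem Plane.inner_eq (x y : Plane) : ⟪x, y⟫ = x 0 * y 0 + x 1 * y 1 := by
  simp only [PiLp.inner_apply, RCLike.inner_apply, conj_trivial, Fin.sum_univ_two]
  ring

theorem Plane.norm_sq_eq (x : Plane) : ‖x‖ ^ 2 = x 0 ^ 2 + x 1 ^ 2 := by
  rw [← real_inner_self_eq_norm_sq, Plane.inner_eq, sq, sq]

theorem Plane.ext {x y : Plane} (h0 : x 0 = y 0) (h1 : x 1 = y 1) : x = y := by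
  ext i
  fin_cases i <;> assumption

@[simp] theorem perp_apply_zero (x : Plane) : perp x 0 = -x 1 := by simp [perp]

@[simp] theorem perp_apply_one (x : Plane) : perp x 1 = x 0 := by simp [perp]

theorem norm_perp (x : Plane) : ‖perp x‖ = ‖x‖ := by
  rw [← sq_eq_sq₀ (norm_nonneg _) (norm_nonneg _), Plane.norm_sq_eq, Plane.norm_sq_eq,
    perp_apply_zero, perp_apply_one]
  ring

/-- The rotation `perp` as a linear isometry. -/
def perpIsometry : Plane →ₗᵢ[ℝ] Plane where
  toFun := perp
  map_add' x y := Plane.ext (by simp; ring) (by simp)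
  map_smul' c x := Plane.ext (by simp) (by simp)
  norm_map' := norm_perp

theorem contDiff_perp {n : WithTop ℕ∞} : ContDiff ℝ n perp := perpIsometry.contDiff

/-- The planar cross product, i.e. the oriented area of the parallelogram spanned by `x`, `y`. -/
def wedge (x y : Plane) : ℝ := x 0 * y 1 - x 1 * y 0

theorem inner_perp (x y : Plane) : ⟪perp x, y⟫ = wedge x y := by
  rw [Plane.inner_eq, wedge, perp_apply_zero, perp_apply_one]
  ring

theorem wedge_swap (x y : Plane) : wedge x y = -wedge y x := by
  unfold wedge
  ring

@[simp] theorem wedge_self (x : Plane) : wedge x x = 0 := by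
  unfold wedge
  ring

@[simp] theorem wedge_zero_left (x : Plane) : wedge 0 x = 0 := by simp [wedge]

@[simp] theorem wedge_zero_right (x : Plane) : wedge x 0 = 0 := by simp [wedge]

theorem wedge_sub_right (x y z : Plane) : wedge x (y - z) = wedge x y - wedge x z := by
  simp only [← inner_perp, inner_sub_right]

theorem inner_perp_self (x : Plane) : ⟪perp x, x⟫ = 0 := by rw [inner_perp, wedge_self]

theorem wedge_smul_eq (x y w : Plane) :
    wedge x y • w = wedge w y • x + wedge x w • y := by
  refine Plane.ext ?_ ?_ <;>
  · simp only [PiLp.add_apply, PiLp.smul_apply, smul_eq_mul, wedge]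
    ring

theorem inner_sq_add_wedge_sq (x y : Plane) : ⟪x, y⟫ ^ 2 + wedge x y ^ 2 = ‖x‖ ^ 2 * ‖y‖ ^ 2 := by
  rw [Plane.inner_eq, Plane.norm_sq_eq, Plane.norm_sq_eq, wedge]
  ring

theorem inner_mul_inner_add_wedge_mul_wedge (x y z : Plane) :
    ⟪x, y⟫ * ⟪x, z⟫ + wedge x y * wedge x z = ‖x‖ ^ 2 * ⟪y, z⟫ := by
  simp only [Plane.inner_eq, Plane.norm_sq_eq, wedge]
  ring

theorem abs_wedge_le (x y : Plane) : |wedge x y| ≤ ‖x‖ * ‖y‖ := by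
  rw [← inner_perp, ← norm_perp x]
  exact abs_real_inner_le_norm _ _

theorem wedge_eq_zero_of_orthogonal {e x y : Plane} (he : e ≠ 0) (hx : ⟪e, x⟫ = 0)
    (hy : ⟪e, y⟫ = 0) : wedge x y = 0 := by
  have h : wedge x y • e = 0 := by
    refine ext_inner_right ℝ fun w => ?_
    have hw : wedge x y * ⟪e, w⟫ = wedge w y * ⟪e, x⟫ + wedge x w * ⟪e, y⟫ := by
      simp only [← real_inner_smul_right, ← inner_add_right, wedge_smul_eq x y w]
    rw [real_inner_smul_left, hw, hx, hy, inner_zero_left, mul_zero, mul_zero, add_zero]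
  exact (smul_eq_zero.1 h).resolve_right he

theorem wedge_ne_zero_of_orthogonal {e f x y : Plane} (he : e ≠ 0) (hf : f ≠ 0)
    (hx : ⟪e, x⟫ = 0) (hy : ⟪f, y⟫ = 0) (h : wedge x y ≠ 0) : wedge e f ≠ 0 := by
  intro hef
  refine h (wedge_eq_zero_of_orthogonal he hx ?_)
  have hsq := inner_sq_add_wedge_sq e f
  have hey := inner_mul_inner_add_wedge_mul_wedge e f y
  rw [hef, sq 0, zero_mul, add_zero] at hsq
  rw [hef, hy, zero_mul, add_zero, mul_zero, mul_eq_zero] at hey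
  refine hey.resolve_left fun hinner => ?_
  rw [hinner, sq 0, zero_mul] at hsq
  exact mul_ne_zero (pow_ne_zero 2 (norm_ne_zero_iff.2 he)) (pow_ne_zero 2 (norm_ne_zero_iff.2 hf))
    hsq.symm

theorem wedge_eq_zero_of_opposite_signs {e x y w : Plane} {κ : ℝ} (he : e ≠ 0) (hκ : κ ≠ 0)
    (hwx : wedge x w ≠ 0) (hwy : wedge w y ≠ 0) (hw : 0 ≤ κ * ⟪e, w⟫)
    (hx : κ * wedge x y * wedge w y * ⟪e, x⟫ ≤ 0) (hy : κ * wedge x y * wedge x w * ⟪e, y⟫ ≤ 0) :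
    wedge x y = 0 := by
  by_contra hT
  have hdecomp : wedge x y * ⟪e, w⟫ = wedge w y * ⟪e, x⟫ + wedge x w * ⟪e, y⟫ := by
    simp only [← real_inner_smul_right, ← inner_add_right]
    rw [wedge_smul_eq]
  have hsum : wedge x y ^ 2 * (κ * ⟪e, w⟫)
      = κ * wedge x y * wedge w y * ⟪e, x⟫ + κ * wedge x y * wedge x w * ⟪e, y⟫ := by
    linear_combination κ * wedge x y * hdecomp
  have hnonneg : 0 ≤ wedge x y ^ 2 * (κ * ⟪e, w⟫) := mul_nonneg (sq_nonneg _) hw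
  have hx0 : κ * wedge x y * wedge w y * ⟪e, x⟫ = 0 := by linarith
  have hy0 : κ * wedge x y * wedge x w * ⟪e, y⟫ = 0 := by linarith
  exact hT (wedge_eq_zero_of_orthogonal he
    ((mul_eq_zero.1 hx0).resolve_left (mul_ne_zero (mul_ne_zero hκ hT) hwy))
    ((mul_eq_zero.1 hy0).resolve_left (mul_ne_zero (mul_ne_zero hκ hT) hwx)))

theorem exists_inner_eq_of_wedge_ne_zero {e f : Plane} (h : wedge e f ≠ 0) (s t : ℝ) :
    ∃ d : Plane, ⟪e, d⟫ = s ∧ ⟪f, d⟫ = t := by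
  refine ⟨(wedge e f)⁻¹ • (t • perp e - s • perp f), ?_, ?_⟩
  all_goals
    rw [real_inner_smul_right, inner_sub_right, real_inner_smul_right, real_inner_smul_right,
      real_inner_comm, real_inner_comm (perp f), inner_perp, inner_perp, wedge_self,
      inv_mul_eq_iff_eq_mul₀ h]
  · rw [wedge_swap f e]
    ring
  · ring

theorem exists_eq_smul_perp {e d : Plane} (he : ‖e‖ = 1) (hd : d ≠ 0) (h : ⟪e, d⟫ = 0) :
    ∃ α : ℝ, (α = 1 ∨ α = -1) ∧ e = (α / ‖d‖) • perp d := by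
  have hd' : ‖d‖ ≠ 0 := norm_ne_zero_iff.2 hd
  refine ⟨wedge d e / ‖d‖, sq_eq_one_iff.1 ?_, ext_inner_right ℝ fun w => ?_⟩
  · have hsq := inner_sq_add_wedge_sq d e
    rw [real_inner_comm, h, he] at hsq
    rw [div_pow, div_eq_one_iff_eq (pow_ne_zero 2 hd')]
    linarith
  · have hw := inner_mul_inner_add_wedge_mul_wedge d e w
    rw [real_inner_comm, h, zero_mul, zero_add] at hw
    rw [real_inner_smul_left, inner_perp]
    field_simp
    rw [hw, mul_comm]

theorem norm_sub_sq_le_two_mul_wedge_sq {e f : Plane} (he : ‖e‖ = 1) (hf : ‖f‖ = 1)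
    (h : 0 ≤ ⟪e, f⟫) : ‖e - f‖ ^ 2 ≤ 2 * wedge e f ^ 2 := by
  have hsq := inner_sq_add_wedge_sq e f
  have hle : ⟪e, f⟫ ≤ 1 := by simpa [he, hf] using real_inner_le_norm e f
  rw [norm_sub_sq_real, he, hf]
  rw [he, hf] at hsq
  nlinarith

/-- The vortex of sign `α` centred at `z`. -/
noncomputable def vortex (α : ℝ) (z w : Plane) : Plane := (α / ‖w - z‖) • perp (w - z)

theorem inner_vortex (α : ℝ) (z w x : Plane) :
    ⟪vortex α z w, x⟫ = α / ‖w - z‖ * wedge (w - z) x := by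
  rw [vortex, real_inner_smul_left, inner_perp]

theorem inner_vortex_sub_self (α : ℝ) (z w : Plane) : ⟪vortex α z w, w - z⟫ = 0 := by
  rw [inner_vortex, wedge_self, mul_zero]

theorem vortex_left_injective {z w : Plane} (h : w ≠ z) :
    Function.Injective fun α => vortex α z w := fun α β hαβ => by
  have hn : ‖w - z‖ ≠ 0 := norm_ne_zero_iff.2 (sub_ne_zero.2 h)
  have hp : perp (w - z) ≠ 0 := by rwa [← norm_ne_zero_iff, norm_perp]
  exact (div_left_inj' hn).1 (smul_left_injective ℝ hp hαβ)

theorem contDiffAt_vortex {n : WithTop ℕ∞} (α : ℝ) {z x : Plane} (h : x ≠ z) :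
    ContDiffAt ℝ n (vortex α z) x := by
  have hsub : ContDiffAt ℝ n (fun w : Plane => w - z) x := contDiffAt_id.sub contDiffAt_const
  have hne : x - z ≠ 0 := sub_ne_zero.2 h
  exact (contDiffAt_const.div (hsub.norm ℝ hne) (norm_ne_zero_iff.2 hne)).smul
    (contDiff_perp.contDiffAt.comp x hsub)

theorem dense_setOf_wedge_ne_zero (z : Plane) {d : Plane} (hd : d ≠ 0) :
    Dense {q | wedge (q - z) d ≠ 0} := by
  intro p
  by_cases hp : wedge (p - z) d = 0
  · have hlim : Tendsto (fun τ : ℝ => p + τ • perp d) (𝓝[>] 0) (𝓝 p) := by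
      have hc : Continuous fun τ : ℝ => p + τ • perp d := by fun_prop
      simpa using (hc.tendsto 0).mono_left nhdsWithin_le_nhds
    refine mem_closure_of_tendsto hlim (eventually_nhdsWithin_of_forall fun τ hτ => ?_)
    have hτd : wedge (p + τ • perp d - z) d = wedge (p - z) d - τ * ‖d‖ ^ 2 := by
      rw [Plane.norm_sq_eq]
      simp only [wedge, PiLp.add_apply, PiLp.sub_apply, PiLp.smul_apply, smul_eq_mul,
        perp_apply_zero, perp_apply_one]
      ring
    rw [Set.mem_ofPred_eq, hτd, hp, zero_sub]
    exact neg_ne_zero.2 (mul_ne_zero (ne_of_gt hτ) (pow_ne_zero 2 (norm_ne_zero_iff.2 hd)))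
  · exact subset_closure hp

theorem isOpen_sector (e f z : Plane) (s t : ℝ) :
    IsOpen {q | 0 < s * ⟪e, q - z⟫ ∧ 0 < t * ⟪f, q - z⟫} := by
  have h : ∀ (e : Plane) (s : ℝ), IsOpen {q : Plane | 0 < s * ⟪e, q - z⟫} := fun e s =>
    isOpen_lt continuous_const (by fun_prop)
  exact (h e s).inter (h f t)

theorem mem_closure_sector {e f : Plane} (h : wedge e f ≠ 0) {s t : ℝ} (hs : s ≠ 0) (ht : t ≠ 0)
    (z : Plane) : z ∈ closure {q | 0 < s * ⟪e, q - z⟫ ∧ 0 < t * ⟪f, q - z⟫} := by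
  obtain ⟨d, hed, hfd⟩ := exists_inner_eq_of_wedge_ne_zero h s t
  have hlim : Tendsto (fun τ : ℝ => z + τ • d) (𝓝[>] 0) (𝓝 z) := by
    have hc : Continuous fun τ : ℝ => z + τ • d := by fun_prop
    simpa using (hc.tendsto 0).mono_left nhdsWithin_le_nhds
  refine mem_closure_of_tendsto hlim (eventually_nhdsWithin_of_forall fun τ (hτ : 0 < τ) => ?_)
  rw [Set.mem_ofPred_eq, add_sub_cancel_left, real_inner_smul_right, real_inner_smul_right, hed,
    hfd, mul_left_comm, mul_left_comm t]
  exact ⟨mul_pos hτ (mul_self_pos.2 hs), mul_pos hτ (mul_self_pos.2 ht)⟩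

end Plane

section CharacteristicField

/-- The properties, at its Lebesgue points `D`, of a unit field `m` on the open set `Ω` that solves
the kinetic equations `ξ · ∇ sign (ξ · m) = 0` for all `ξ`: they are what the geometric part of
the argument uses about `m`. `cluster` makes `m x` an approximate limit inside every half disc
around `x`. -/
structure IsCharacteristicField (Ω D : Set Plane) (m : Plane → Plane) : Prop where
  isOpen : IsOpen Ω
  subset : D ⊆ Ω
  dense : Ω ⊆ closure D
  norm_eq_one : ∀ x ∈ D, ‖m x‖ = 1
  sign : ∀ x ∈ D, ∀ y ∈ D, segment ℝ x y ⊆ Ω → 0 ≤ ⟪m x, y - x⟫ * ⟪m y, y - x⟫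
  cluster : ∀ x ∈ D, ∀ e : Plane, e ≠ 0 → MapClusterPt (m x) (𝓝[D ∩ {z | 0 < ⟪e, z - x⟫}] x) m

/-- The characteristics of `m` through `x` and `y`, i.e. the lines orthogonal to `m x` at `x` and to
`m y` at `y`, meet transversally at `z`. -/
structure Crosses (D : Set Plane) (m : Plane → Plane) (z x y : Plane) : Prop where
  left_mem : x ∈ D
  right_mem : y ∈ D
  left : ⟪m x, x - z⟫ = 0
  right : ⟪m y, y - z⟫ = 0
  transversal : wedge (x - z) (y - z) ≠ 0

theorem Crosses.left_ne {D : Set Plane} {m : Plane → Plane} {z x y : Plane}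
    (hX : Crosses D m z x y) : x ≠ z := by
  rintro rfl
  exact hX.transversal (by simp)

theorem Crosses.right_ne {D : Set Plane} {m : Plane → Plane} {z x y : Plane}
    (hX : Crosses D m z x y) : y ≠ z := by
  rintro rfl
  exact hX.transversal (by simp)

namespace IsCharacteristicField

variable {Ω D U : Set Plane} {m : Plane → Plane}

theorem restrict (H : IsCharacteristicField Ω D m) (hU : IsOpen U) (hUΩ : U ⊆ Ω) :
    IsCharacteristicField U (D ∩ U) m where
  isOpen := hU
  subset := Set.inter_subset_right
  dense x hx := by
    rw [Set.inter_comm]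
    exact hU.inter_closure ⟨hx, H.dense (hUΩ hx)⟩
  norm_eq_one x hx := H.norm_eq_one x hx.1
  sign x hx y hy hxy := H.sign x hx.1 y hy.1 (hxy.trans hUΩ)
  cluster x hx e he := by
    rw [Set.inter_right_comm, nhdsWithin_inter_of_mem' (mem_nhdsWithin_of_mem_nhds
      (hU.mem_nhds hx.2))]
    exact H.cluster x hx.1 e he

theorem ne_zero (H : IsCharacteristicField Ω D m) {x : Plane} (hx : x ∈ D) : m x ≠ 0 :=
  norm_ne_zero_iff.1 (by rw [H.norm_eq_one x hx]; exact one_ne_zero)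

theorem segment_subset (H : IsCharacteristicField Ω D m) (hc : Convex ℝ Ω) {x y : Plane}
    (hx : x ∈ D) (hy : y ∈ D) : segment ℝ x y ⊆ Ω :=
  hc.segment_subset (H.subset hx) (H.subset hy)

theorem nonneg_of_tendsto (H : IsCharacteristicField Ω D m) (hc : Convex ℝ Ω) {F : Filter Plane}
    [F.NeBot] {z e : Plane} (hFD : D ∈ F) (hFz : F ≤ 𝓝 z) (hm : Tendsto m F (𝓝 e)) {p : Plane}
    (hp : p ∈ D) {s : ℝ} (hs : ∀ᶠ q in F, 0 < s * ⟪m p, q - p⟫) : 0 ≤ s * ⟪e, z - p⟫ := by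
  have hlim : Tendsto (fun q => s * ⟪m q, q - p⟫) F (𝓝 (s * ⟪e, z - p⟫)) :=
    (hm.inner ((tendsto_id.mono_right hFz).sub_const p)).const_mul s
  refine ge_of_tendsto hlim ?_
  filter_upwards [hs, hFD] with q hsq hq
  have hsign := H.sign p hp q hq (H.segment_subset hc hp hq)
  have hprod : 0 ≤ (s * ⟪m p, q - p⟫) * (s * ⟪m q, q - p⟫) := by
    rw [mul_mul_mul_comm]
    exact mul_nonneg (mul_self_nonneg s) hsign
  exact nonneg_of_mul_nonneg_right hprod hsq

theorem inner_eq_zero_of_inner_eq_zero (H : IsCharacteristicField Ω D m) (hc : Convex ℝ Ω)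
    {x y : Plane} (hx : x ∈ D) (hy : y ∈ D) (h : ⟪m x, y - x⟫ = 0) : ⟪m y, y - x⟫ = 0 := by
  by_contra hne
  obtain ⟨F, hF, hFm⟩ := mapClusterPt_iff_ultrafilter.1
    (H.cluster y hy (-⟪m y, y - x⟫ • m x) (smul_ne_zero (neg_ne_zero.2 hne) (H.ne_zero hx)))
  have hFmem : D ∩ {z | 0 < ⟪-⟪m y, y - x⟫ • m x, z - y⟫} ∈ (F : Filter Plane) :=
    hF self_mem_nhdsWithin
  have hside : ∀ᶠ z in (F : Filter Plane), 0 < -⟪m y, y - x⟫ * ⟪m x, z - x⟫ := by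
    filter_upwards [hFmem] with z hz
    have hzx : ⟪m x, z - x⟫ = ⟪m x, z - y⟫ := by
      rw [← sub_add_sub_cancel z y x, inner_add_right, h, add_zero]
    rw [hzx, ← real_inner_smul_left]
    exact hz.2
  have hlim := H.nonneg_of_tendsto hc (mem_of_superset hFmem Set.inter_subset_left)
    (hF.trans nhdsWithin_le_nhds) hFm hx hside
  have hsq := mul_self_pos.2 hne
  linarith

theorem inner_eq_zero_iff (H : IsCharacteristicField Ω D m) (hc : Convex ℝ Ω) {x y : Plane}
    (hx : x ∈ D) (hy : y ∈ D) : ⟪m x, y - x⟫ = 0 ↔ ⟪m y, y - x⟫ = 0 := by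
  refine ⟨H.inner_eq_zero_of_inner_eq_zero hc hx hy, fun h => ?_⟩
  rw [← neg_sub, inner_neg_right, neg_eq_zero] at h ⊢
  exact H.inner_eq_zero_of_inner_eq_zero hc hy hx h

theorem exists_tendsto_in_sector (H : IsCharacteristicField Ω D m) {e f z : Plane} (hz : z ∈ Ω)
    (h : wedge e f ≠ 0) {s t : ℝ} (hs : s ≠ 0) (ht : t ≠ 0) :
    ∃ F : Ultrafilter Plane, D ∈ F ∧ ↑F ≤ 𝓝 z ∧ (∀ᶠ q in F, 0 < s * ⟪e, q - z⟫) ∧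
      (∀ᶠ q in F, 0 < t * ⟪f, q - z⟫) ∧ ∃ l, l ≠ 0 ∧ Tendsto m F (𝓝 l) := by
  set A := {q | 0 < s * ⟪e, q - z⟫ ∧ 0 < t * ⟪f, q - z⟫}
  have hz' : z ∈ closure (D ∩ A) := by
    rw [_root_.mem_closure_iff]
    intro V hV hzV
    obtain ⟨q, ⟨hqV, hqΩ⟩, hqA⟩ :=
      _root_.mem_closure_iff.1 (mem_closure_sector h hs ht z) _ (hV.inter H.isOpen) ⟨hzV, hz⟩
    obtain ⟨q', hq', hq'D⟩ :=
      _root_.mem_closure_iff.1 (H.dense hqΩ) _ (hV.inter (isOpen_sector e f z s t)) ⟨hqV, hqA⟩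
    exact ⟨q', hq'.1, hq'D, hq'.2⟩
  obtain ⟨F, hFA, hFz⟩ := mem_closure_iff_ultrafilter.1 hz'
  have hsphere : sphere (0 : Plane) 1 ∈ F.map m :=
    Ultrafilter.mem_map.2 (mem_of_superset hFA fun x hx => by
      simpa using H.norm_eq_one x hx.1)
  obtain ⟨l, hl, hFl⟩ := (isCompact_sphere (0 : Plane) 1).ultrafilter_le_nhds' _ hsphere
  exact ⟨F, mem_of_superset hFA Set.inter_subset_left, hFz, mem_of_superset hFA fun q hq => hq.2.1,
    mem_of_superset hFA fun q hq => hq.2.2, l, ne_zero_of_mem_unit_sphere ⟨l, hl⟩, hFl⟩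

theorem inner_eq_zero_of_crosses (H : IsCharacteristicField Ω D m) (hc : Convex ℝ Ω)
    {x y z w : Plane} (hz : z ∈ Ω) (hX : Crosses D m z x y) (hw : w ∈ D)
    (hwx : wedge (x - z) (w - z) ≠ 0) (hwy : wedge (w - z) (y - z) ≠ 0) :
    ⟪m w, w - z⟫ = 0 := by
  by_contra hκ
  obtain ⟨hx, hy, hxz, hyz, hT⟩ := hX
  set κ := ⟪m w, w - z⟫ with hκdef
  have hmxy : wedge (m x) (m y) ≠ 0 :=
    wedge_ne_zero_of_orthogonal (H.ne_zero hx) (H.ne_zero hy) hxz hyz hT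
  -- In this sector the sign rules of `x`, `y` and `w` confine the limits of `m q` as `q → z` to
  -- half planes with no common point.
  obtain ⟨F, hFD, hFz, hqx, hqy, e, he, hFe⟩ := H.exists_tendsto_in_sector hz hmxy
    (mul_ne_zero (mul_ne_zero hκ hT) hwy) (mul_ne_zero (mul_ne_zero hκ hT) hwx)
  have shift : ∀ {p p' : Plane}, ⟪p, p' - z⟫ = 0 → ∀ q, ⟪p, q - p'⟫ = ⟪p, q - z⟫ := by
    intro p p' h q
    rw [← sub_sub_sub_cancel_right q p' z, inner_sub_right, h, sub_zero]
  have hex := H.nonneg_of_tendsto hc hFD hFz hFe hx (by simpa only [shift hxz] using hqx)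
  have hey := H.nonneg_of_tendsto hc hFD hFz hFe hy (by simpa only [shift hyz] using hqy)
  have hew : 0 ≤ -κ * ⟪e, z - w⟫ := by
    refine H.nonneg_of_tendsto hc hFD hFz hFe hw ?_
    have hlim : Tendsto (fun q => -κ * ⟪m w, q - w⟫) F (𝓝 (-κ * ⟪m w, z - w⟫)) :=
      (tendsto_const_nhds.inner ((tendsto_id.mono_right hFz).sub_const w)).const_mul _
    refine hlim.eventually_const_lt ?_
    rw [← neg_sub w z, inner_neg_right, ← hκdef, neg_mul_neg]
    exact mul_self_pos.2 hκ
  have flip : ∀ p : Plane, ⟪e, z - p⟫ = -⟪e, p - z⟫ := fun p => by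
    rw [← inner_neg_right, neg_sub]
  rw [flip] at hex hey hew
  exact hT (wedge_eq_zero_of_opposite_signs he hκ hwx hwy (by linarith) (by linarith)
    (by linarith))

theorem exists_mem_wedge_ne_zero (H : IsCharacteristicField Ω D m) (hne : Ω.Nonempty) (z : Plane)
    {s : Set Plane} (hs : s.Finite) (h0 : 0 ∉ s) : ∃ q ∈ D, ∀ d ∈ s, wedge (q - z) d ≠ 0 := by
  have hopen : ∀ d, IsOpen {q : Plane | wedge (q - z) d ≠ 0} := fun d =>
    isOpen_ne_fun (by unfold wedge; fun_prop) continuous_const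
  have hdense : Dense (⋂ d ∈ s, {q : Plane | wedge (q - z) d ≠ 0}) :=
    dense_biInter_of_isOpen (fun d _ => hopen d) hs.countable
      fun d hd => dense_setOf_wedge_ne_zero z (ne_of_mem_of_not_mem hd h0)
  obtain ⟨p, hpΩ, hp⟩ := hdense.inter_open_nonempty Ω H.isOpen hne
  obtain ⟨q, hq, hqD⟩ := _root_.mem_closure_iff.1 (H.dense hpΩ) _
    (hs.isOpen_biInter fun d _ => hopen d) hp
  exact ⟨q, hqD, fun d hd => Set.mem_iInter₂.1 hq d hd⟩

theorem vortex_sign_eq (H : IsCharacteristicField Ω D m) (hc : Convex ℝ Ω) {x y z : Plane}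
    (hx : x ∈ D) (hy : y ∈ D) {α β : ℝ} (hα : α = 1 ∨ α = -1) (hβ : β = 1 ∨ β = -1)
    (hmx : m x = vortex α z x) (hmy : m y = vortex β z y) (h : wedge (x - z) (y - z) ≠ 0) :
    α = β := by
  have hxz : 0 < ‖x - z‖ := norm_pos_iff.2 fun h0 => h (by rw [h0, wedge_zero_left])
  have hyz : 0 < ‖y - z‖ := norm_pos_iff.2 fun h0 => h (by rw [h0, wedge_zero_right])
  have hs := H.sign x hx y hy (H.segment_subset hc hx hy)
  rw [hmx, hmy, inner_vortex, inner_vortex, ← sub_sub_sub_cancel_right y x z,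
    wedge_sub_right _ (y - z), wedge_sub_right _ (y - z), wedge_self, wedge_self,
    wedge_swap (y - z)] at hs
  set T := wedge (x - z) (y - z)
  have hprod : 0 ≤ α * β * (T ^ 2 / (‖x - z‖ * ‖y - z‖)) := by
    convert hs using 1
    field_simp
    ring
  have hαβ : 0 ≤ α * β := nonneg_of_mul_nonneg_left hprod (by positivity)
  rcases hα with rfl | rfl <;> rcases hβ with rfl | rfl <;> first | rfl | norm_num at hαβ

/-- Two auxiliary points of `D` in general position transport the crossing at `z` to `w` when `w`
lies on one of the two given characteristics. -/
theorem inner_eq_zero_of_crosses_of_ne (H : IsCharacteristicField Ω D m) (hc : Convex ℝ Ω)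
    {x y z w : Plane} (hz : z ∈ Ω) (hX : Crosses D m z x y) (hw : w ∈ D) (hwz : w ≠ z) :
    ⟪m w, w - z⟫ = 0 := by
  have hxz := sub_ne_zero.2 hX.left_ne
  have hyz := sub_ne_zero.2 hX.right_ne
  obtain ⟨x', hx', hx's⟩ := H.exists_mem_wedge_ne_zero ⟨z, hz⟩ z
    (s := {x - z, y - z, w - z}) (by simp) (by simp [hxz.symm, hyz.symm, (sub_ne_zero.2 hwz).symm])
  simp only [Set.mem_insert_iff, Set.mem_singleton_iff, forall_eq_or_imp, forall_eq] at hx's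
  obtain ⟨hx'x, hx'y, hx'w⟩ := hx's
  have hx'z : x' - z ≠ 0 := fun h0 => hx'x (by rw [h0, wedge_zero_left])
  obtain ⟨y', hy', hy's⟩ := H.exists_mem_wedge_ne_zero ⟨z, hz⟩ z
    (s := {x - z, y - z, w - z, x' - z}) (by simp)
    (by simp [hxz.symm, hyz.symm, (sub_ne_zero.2 hwz).symm, hx'z.symm])
  simp only [Set.mem_insert_iff, Set.mem_singleton_iff, forall_eq_or_imp, forall_eq] at hy's
  obtain ⟨hy'x, hy'y, hy'w, hy'x'⟩ := hy's
  have swap : ∀ {p q : Plane}, wedge p q ≠ 0 → wedge q p ≠ 0 := fun h => by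
    rwa [wedge_swap, neg_ne_zero]
  have hX' : Crosses D m z x' y' :=
    ⟨hx', hy', H.inner_eq_zero_of_crosses hc hz hX hx' (swap hx'x) hx'y,
      H.inner_eq_zero_of_crosses hc hz hX hy' (swap hy'x) hy'y, swap hy'x'⟩
  exact H.inner_eq_zero_of_crosses hc hz hX' hw hx'w (swap hy'w)

theorem exists_eqOn_vortex_of_crosses (H : IsCharacteristicField Ω D m) (hc : Convex ℝ Ω)
    {x y z : Plane} (hz : z ∈ Ω) (hX : Crosses D m z x y) :
    ∃ α : ℝ, (α = 1 ∨ α = -1) ∧ Set.EqOn m (vortex α z) (D \ {z}) := by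
  have hvortex : ∀ w ∈ D, w ≠ z → ∃ α : ℝ, (α = 1 ∨ α = -1) ∧ m w = vortex α z w :=
    fun w hw hwz => exists_eq_smul_perp (H.norm_eq_one w hw) (sub_ne_zero.2 hwz)
      (H.inner_eq_zero_of_crosses_of_ne hc hz hX hw hwz)
  obtain ⟨α, hα, hmx⟩ := hvortex x hX.left_mem hX.left_ne
  refine ⟨α, hα, fun w ⟨hw, hwz⟩ => ?_⟩
  obtain ⟨β, hβ, hmw⟩ := hvortex w hw hwz
  obtain ⟨q, hq, hqs⟩ := H.exists_mem_wedge_ne_zero ⟨z, hz⟩ z (s := {x - z, w - z}) (by simp)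
    (by simp [(sub_ne_zero.2 hX.left_ne).symm, (sub_ne_zero.2 hwz).symm])
  simp only [Set.mem_insert_iff, Set.mem_singleton_iff, forall_eq_or_imp, forall_eq] at hqs
  have hqz : q ≠ z := by
    rintro rfl
    exact hqs.1 (by simp)
  obtain ⟨γ, hγ, hmq⟩ := hvortex q hq hqz
  have hγα := H.vortex_sign_eq hc hq hX.left_mem hγ hα hmq hmx hqs.1
  have hγβ := H.vortex_sign_eq hc hq hw hγ hβ hmq hmw hqs.2
  rw [hmw, ← hγβ, hγα]

theorem center_unique (H : IsCharacteristicField Ω D m) (hne : Ω.Nonempty) {z z' : Plane}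
    {α α' : ℝ} (h : Set.EqOn m (vortex α z) (D \ {z}))
    (h' : Set.EqOn m (vortex α' z') (D \ {z'})) : z = z' := by
  by_contra hzz
  obtain ⟨w, hw, hwz⟩ := H.exists_mem_wedge_ne_zero hne z (Set.finite_singleton (z' - z))
    (by simp [(sub_ne_zero.2 (Ne.symm hzz)).symm])
  have hwedge : wedge (w - z) (w - z') ≠ 0 := by
    rw [← sub_sub_sub_cancel_right w z' z, wedge_sub_right, wedge_self, zero_sub, neg_ne_zero]
    exact hwz _ rfl
  have hw1 : w ≠ z := by
    rintro rfl
    simp at hwedge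
  have hw2 : w ≠ z' := by
    rintro rfl
    simp at hwedge
  refine hwedge (wedge_eq_zero_of_orthogonal (H.ne_zero hw) ?_ ?_)
  · rw [h ⟨hw, hw1⟩, inner_vortex_sub_self]
  · rw [h' ⟨hw, hw2⟩, inner_vortex_sub_self]

end IsCharacteristicField
end CharacteristicField

section Lipschitz

theorem wedge_perp_left (x y : Plane) : wedge (perp x) y = -⟪x, y⟫ := by
  rw [wedge, Plane.inner_eq, perp_apply_zero, perp_apply_one]
  ring

theorem inner_nonneg_of_abs_wedge_mul_le {e f d : Plane} (he : ‖e‖ = 1)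
    (hpos : 0 < ⟪e, d⟫ * ⟪f, d⟫) (h : |wedge e f| * ‖d‖ ≤ |⟪f, d⟫|) : 0 ≤ ⟪e, f⟫ := by
  have hid := inner_mul_inner_add_wedge_mul_wedge e f d
  rw [he, one_pow, one_mul] at hid
  have hwedge : |wedge e d| ≤ ‖d‖ := by simpa [he] using abs_wedge_le e d
  have hle : ⟪f, d⟫ * (wedge e f * wedge e d) ≤ ⟪f, d⟫ ^ 2 := by
    calc ⟪f, d⟫ * (wedge e f * wedge e d) ≤ |⟪f, d⟫| * (|wedge e f| * |wedge e d|) := by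
          rw [← abs_mul, ← abs_mul]
          exact le_abs_self _
      _ ≤ |⟪f, d⟫| * |⟪f, d⟫| := by
          gcongr
          exact (by gcongr : |wedge e f| * |wedge e d| ≤ |wedge e f| * ‖d‖).trans h
      _ = ⟪f, d⟫ ^ 2 := by rw [abs_mul_abs_self, sq]
  refine nonneg_of_mul_nonneg_right ?_ hpos
  linear_combination hle - ⟪f, d⟫ * hid

theorem norm_sub_le_of_abs_wedge_mul_le {e f d : Plane} {R : ℝ} (hR : 0 < R) (he : ‖e‖ = 1)
    (hf : ‖f‖ = 1) (hpos : 0 < ⟪e, d⟫ * ⟪f, d⟫) (hd : ‖d‖ ≤ R)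
    (h : |wedge e f| * R ≤ |⟪f, d⟫|) : ‖e - f‖ ≤ 2 / R * ‖d‖ := by
  have hinner : 0 ≤ ⟪e, f⟫ :=
    inner_nonneg_of_abs_wedge_mul_le he hpos (le_trans (by gcongr) h)
  have hwedge : |wedge e f| ≤ ‖d‖ / R := by
    rw [le_div_iff₀ hR]
    exact h.trans (by simpa [hf] using abs_real_inner_le_norm f d)
  have hsq : wedge e f ^ 2 ≤ (‖d‖ / R) ^ 2 := sq_le_sq' (abs_le.1 hwedge).1 (abs_le.1 hwedge).2
  refine (sq_le_sq₀ (norm_nonneg _) (by positivity)).1 ?_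
  calc ‖e - f‖ ^ 2 ≤ 2 * wedge e f ^ 2 := norm_sub_sq_le_two_mul_wedge_sq he hf hinner
    _ ≤ 4 * (‖d‖ / R) ^ 2 := by linarith [sq_nonneg (wedge e f)]
    _ = (2 / R * ‖d‖) ^ 2 := by ring

theorem crosses_add_smul_perp {D : Set Plane} {m : Plane → Plane} {x y : Plane} (hx : x ∈ D)
    (hy : y ∈ D) (hwedge : wedge (m x) (m y) ≠ 0) (hmx : ⟪m x, y - x⟫ ≠ 0)
    (hmy : ⟪m y, y - x⟫ ≠ 0) :
    Crosses D m (x + (⟪m y, y - x⟫ / wedge (m x) (m y)) • perp (m x)) x y := by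
  set τ := ⟪m y, y - x⟫ / wedge (m x) (m y) with hτ
  refine ⟨hx, hy, ?_, ?_, ?_⟩
  · rw [sub_add_cancel_left, inner_neg_right, real_inner_smul_right, real_inner_comm,
      inner_perp_self, mul_zero, neg_zero]
  · rw [← sub_sub, inner_sub_right, real_inner_smul_right, real_inner_comm (perp (m x)),
      inner_perp, hτ, div_mul_cancel₀ _ hwedge, sub_self]
  · have heq : wedge (x - (x + τ • perp (m x))) (y - (x + τ • perp (m x)))
        = τ * ⟪m x, y - x⟫ := by
      rw [sub_add_cancel_left, ← sub_sub, wedge_sub_right, ← inner_perp, ← inner_perp,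
        ← neg_neg ⟪m x, y - x⟫, ← wedge_perp_left]
      simp only [inner_perp, wedge, PiLp.neg_apply, PiLp.smul_apply, smul_eq_mul]
      ring
    rw [heq]
    exact mul_ne_zero (div_ne_zero hmy hwedge) hmx

namespace IsCharacteristicField

variable {Ω D U : Set Plane} {m : Plane → Plane} {c : Plane} {R : ℝ}

theorem norm_sub_le_of_inner_ne_zero (H : IsCharacteristicField (ball c R) D m) (hR : 0 < R)
    (hno : ∀ z ∈ ball c R, ∀ x y, ¬ Crosses D m z x y) {x y : Plane} (hx : x ∈ D)
    (hxc : x ∈ ball c (R / 4)) (hy : y ∈ D) (hyc : y ∈ ball c (R / 4))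
    (h : ⟪m x, y - x⟫ ≠ 0) : ‖m x - m y‖ ≤ 4 / R * ‖x - y‖ := by
  have hc := convex_ball c R
  have hmy : ⟪m y, y - x⟫ ≠ 0 := fun h0 => h ((H.inner_eq_zero_iff hc hx hy).2 h0)
  have hpos : 0 < ⟪m x, y - x⟫ * ⟪m y, y - x⟫ :=
    (H.sign x hx y hy (H.segment_subset hc hx hy)).lt_of_ne' (mul_ne_zero h hmy)
  rw [mem_ball] at hxc hyc
  have hxy : ‖y - x‖ ≤ R / 2 := by
    rw [← dist_eq_norm]
    linarith [dist_triangle_right y x c]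
  have hfar : |wedge (m x) (m y)| * (R / 2) ≤ |⟪m y, y - x⟫| := by
    by_cases hw : wedge (m x) (m y) = 0
    · simp [hw]
    set τ := ⟪m y, y - x⟫ / wedge (m x) (m y) with hτ
    have hout : x + τ • perp (m x) ∉ ball c R := fun hin =>
      hno _ hin x y (crosses_add_smul_perp hx hy hw h hmy)
    have hdist : dist (x + τ • perp (m x)) x = |τ| := by
      rw [dist_self_add_left, norm_smul, norm_perp, H.norm_eq_one x hx, mul_one, Real.norm_eq_abs]
    rw [mem_ball, not_lt] at hout
    have hτR : R / 2 ≤ |τ| := by linarith [dist_triangle (x + τ • perp (m x)) x c]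
    calc |wedge (m x) (m y)| * (R / 2) ≤ |wedge (m x) (m y)| * |τ| := by gcongr
      _ = |⟪m y, y - x⟫| := by rw [hτ, abs_div, mul_div_cancel₀ _ (abs_ne_zero.2 hw)]
  rw [norm_sub_rev x y]
  calc ‖m x - m y‖ ≤ 2 / (R / 2) * ‖y - x‖ := norm_sub_le_of_abs_wedge_mul_le (half_pos hR)
        (H.norm_eq_one x hx) (H.norm_eq_one y hy) hpos hxy hfar
    _ = 4 / R * ‖y - x‖ := by ring

theorem lipschitzOnWith_of_forall_not_crosses (H : IsCharacteristicField (ball c R) D m)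
    (hR : 0 < R) (hno : ∀ z ∈ ball c R, ∀ x y, ¬ Crosses D m z x y) :
    LipschitzOnWith (4 / R).toNNReal m (D ∩ ball c (R / 4)) := by
  refine LipschitzOnWith.of_dist_le_mul fun x hx y hy => ?_
  rw [Real.coe_toNNReal _ (by positivity), dist_eq_norm, dist_eq_norm]
  by_cases h : ⟪m x, y - x⟫ = 0
  · obtain ⟨F, hF, hFm⟩ :=
      mapClusterPt_iff_ultrafilter.1 (H.cluster y hy.1 (m x) (H.ne_zero hx.1))
    have hFy : ↑F ≤ 𝓝 y := hF.trans nhdsWithin_le_nhds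
    refine le_of_tendsto_of_tendsto (hFm.const_sub (m x)).norm
      (((tendsto_id.mono_right hFy).const_sub x).norm.const_mul (4 / R)) ?_
    filter_upwards [hF self_mem_nhdsWithin, hFy (isOpen_ball.mem_nhds hy.2)] with z hzD hzc
    refine H.norm_sub_le_of_inner_ne_zero hR hno hx.1 hx.2 hzD.1 hzc ?_
    rw [← sub_add_sub_cancel z y x, inner_add_right, h, add_zero]
    exact (ne_of_gt hzD.2)
  · exact H.norm_sub_le_of_inner_ne_zero hR hno hx.1 hx.2 hy.1 hy.2 h

end IsCharacteristicField
end Lipschitz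

section VortexSet

/-- The points of `Ω` near which `m` is, on `D`, a vortex of degree one; these are the singularities
of a characteristic field. -/
def vortexSet (Ω D : Set Plane) (m : Plane → Plane) : Set Plane :=
  {P | P ∈ Ω ∧ ∃ α : ℝ, (α = 1 ∨ α = -1) ∧ ∀ᶠ x in 𝓝[D \ {P}] P, m x = vortex α P x}

theorem exists_isOpen_eqOn_vortex {D : Set Plane} {m : Plane → Plane} {α : ℝ}
    {P : Plane} (h : ∀ᶠ x in 𝓝[D \ {P}] P, m x = vortex α P x) :
    ∃ V, IsOpen V ∧ P ∈ V ∧ Set.EqOn m (vortex α P) ((D ∩ V) \ {P}) := by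
  obtain ⟨V, hV, hPV, hVm⟩ := mem_nhdsWithin.1 h
  exact ⟨V, hV, hPV, fun x hx => hVm ⟨hx.1.2, hx.1.1, hx.2⟩⟩

namespace IsCharacteristicField

variable {Ω D U : Set Plane} {m : Plane → Plane}

theorem exists_crosses (H : IsCharacteristicField Ω D m) {α : ℝ} {P : Plane} (hne : Ω.Nonempty)
    (h : Set.EqOn m (vortex α P) (D \ {P})) : ∃ x y, Crosses D m P x y := by
  obtain ⟨d, hd⟩ := exists_ne (0 : Plane)
  obtain ⟨x, hx, hxd⟩ := H.exists_mem_wedge_ne_zero hne P (Set.finite_singleton d) (by simpa using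
    hd.symm)
  have hxP : x ≠ P := by
    rintro rfl
    simpa using hxd d rfl
  obtain ⟨y, hy, hyx⟩ := H.exists_mem_wedge_ne_zero hne P (Set.finite_singleton (x - P))
    (by simpa using (sub_ne_zero.2 hxP).symm)
  have hyP : y ≠ P := by
    rintro rfl
    simpa using hyx (x - y) rfl
  refine ⟨x, y, hx, hy, ?_, ?_, ?_⟩
  · rw [h ⟨hx, hxP⟩, inner_vortex_sub_self]
  · rw [h ⟨hy, hyP⟩, inner_vortex_sub_self]
  · rw [wedge_swap, neg_ne_zero]
    exact hyx _ rfl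

theorem vortex_sign_unique (H : IsCharacteristicField Ω D m) {α β : ℝ} {P : Plane}
    (hne : Ω.Nonempty) (hα : Set.EqOn m (vortex α P) (D \ {P}))
    (hβ : Set.EqOn m (vortex β P) (D \ {P})) : α = β := by
  obtain ⟨x, y, hX⟩ := H.exists_crosses hne hα
  exact vortex_left_injective hX.left_ne
    ((hα ⟨hX.left_mem, hX.left_ne⟩).symm.trans (hβ ⟨hX.left_mem, hX.left_ne⟩))

theorem exists_eqOn_vortex (H : IsCharacteristicField Ω D m) {P : Plane}
    (hP : P ∈ vortexSet Ω D m) : ∃ α : ℝ, (α = 1 ∨ α = -1) ∧ ∀ U, IsOpen U → Convex ℝ U →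
      U ⊆ Ω → P ∈ U → Set.EqOn m (vortex α P) ((D ∩ U) \ {P}) := by
  obtain ⟨-, α, hα, hev⟩ := hP
  refine ⟨α, hα, fun U hU hUc hUΩ hPU => ?_⟩
  obtain ⟨V, hV, hPV, hVm⟩ := exists_isOpen_eqOn_vortex hev
  have hUV : Set.EqOn m (vortex α P) ((D ∩ (U ∩ V)) \ {P}) :=
    hVm.mono (by gcongr; exact Set.inter_subset_right)
  have HUV := H.restrict (hU.inter hV) (Set.inter_subset_left.trans hUΩ)
  obtain ⟨x, y, hX⟩ := HUV.exists_crosses ⟨P, hPU, hPV⟩ hUV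
  obtain ⟨β, -, hβ⟩ := (H.restrict hU hUΩ).exists_eqOn_vortex_of_crosses hUc hPU
    { hX with
      left_mem := ⟨hX.left_mem.1, hX.left_mem.2.1⟩
      right_mem := ⟨hX.right_mem.1, hX.right_mem.2.1⟩ }
  have hUVβ : Set.EqOn m (vortex β P) ((D ∩ (U ∩ V)) \ {P}) :=
    hβ.mono (by gcongr; exact Set.inter_subset_left)
  rwa [HUV.vortex_sign_unique ⟨P, hPU, hPV⟩ hUV hUVβ]

theorem notMem_vortexSet (H : IsCharacteristicField Ω D m) {x : Plane} (hx : x ∈ D) :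
    x ∉ vortexSet Ω D m := fun hP => by
  obtain ⟨α, -, hα⟩ := H.exists_eqOn_vortex hP
  obtain ⟨r, hr, hrΩ⟩ := isOpen_iff.1 H.isOpen x hP.1
  have hB := H.restrict isOpen_ball hrΩ
  have hxB : x ∈ D ∩ ball x r := ⟨hx, mem_ball_self hr⟩
  obtain ⟨a, b, hX⟩ := hB.exists_crosses ⟨x, mem_ball_self hr⟩
    (hα _ isOpen_ball (convex_ball x r) hrΩ (mem_ball_self hr))
  have orthogonal : ∀ {p}, p ∈ D ∩ ball x r → ⟪m p, p - x⟫ = 0 → ⟪m x, p - x⟫ = 0 :=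
    fun hp h => (hB.inner_eq_zero_iff (convex_ball x r) hxB hp).2 h
  exact hX.transversal (wedge_eq_zero_of_orthogonal (H.ne_zero hx) (orthogonal hX.left_mem hX.left)
    (orthogonal hX.right_mem hX.right))

theorem eq_of_mem_vortexSet (H : IsCharacteristicField Ω D m) {P Q : Plane}
    (hP : P ∈ vortexSet Ω D m) (hQ : Q ∈ vortexSet Ω D m) (hU : IsOpen U) (hc : Convex ℝ U)
    (hUΩ : U ⊆ Ω) (hPU : P ∈ U) (hQU : Q ∈ closure U) : P = Q := by
  obtain ⟨α, -, hα⟩ := H.exists_eqOn_vortex hP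
  obtain ⟨β, -, hβ⟩ := hQ.2
  obtain ⟨V, hV, hQV, hVm⟩ := exists_isOpen_eqOn_vortex hβ
  have hne : (U ∩ V).Nonempty := by
    rw [Set.inter_comm]
    exact _root_.mem_closure_iff.1 hQU V hV hQV
  refine (H.restrict (hU.inter hV) (Set.inter_subset_left.trans hUΩ)).center_unique hne
    ((hα U hU hc hUΩ hPU).mono ?_) (hVm.mono ?_)
  · gcongr
    exact Set.inter_subset_left
  · gcongr
    exact Set.inter_subset_right

theorem exists_finite_inter_vortexSet (H : IsCharacteristicField Ω D m) {x : Plane} (hx : x ∈ Ω) :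
    ∃ V ∈ 𝓝 x, (V ∩ vortexSet Ω D m).Finite := by
  obtain ⟨R, hR, hRΩ⟩ := isOpen_iff.1 H.isOpen x hx
  refine ⟨ball x R, ball_mem_nhds x hR, Set.Subsingleton.finite ?_⟩
  exact fun P hP Q hQ => H.eq_of_mem_vortexSet hP.2 hQ.2 isOpen_ball (convex_ball x R) hRΩ hP.1
    (subset_closure hQ.1)

theorem exists_lipschitzOnWith (H : IsCharacteristicField Ω D m) {x : Plane} (hx : x ∈ Ω)
    (hxS : x ∉ vortexSet Ω D m) : ∃ K, ∃ t ∈ 𝓝 x, t ⊆ Ω ∧ LipschitzOnWith K m (D ∩ t) := by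
  obtain ⟨R, hR, hRΩ⟩ := isOpen_iff.1 H.isOpen x hx
  have HB := H.restrict isOpen_ball hRΩ
  by_cases! hX : ∃ z ∈ ball x R, ∃ a b, Crosses (D ∩ ball x R) m z a b
  · obtain ⟨z, hz, a, b, hX⟩ := hX
    obtain ⟨α, hα, hv⟩ := HB.exists_eqOn_vortex_of_crosses (convex_ball x R) hz hX
    have hxz : x ≠ z := by
      rintro rfl
      refine hxS ⟨hx, α, hα, ?_⟩
      filter_upwards [self_mem_nhdsWithin, nhdsWithin_le_nhds (ball_mem_nhds x hR)] with q hqD hqR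
      exact hv ⟨⟨hqD.1, hqR⟩, hqD.2⟩
    obtain ⟨K, t, ht, hK⟩ := (contDiffAt_vortex α hxz).exists_lipschitzOnWith
    refine ⟨K, t ∩ ball x R ∩ {z}ᶜ, inter_mem (inter_mem ht (ball_mem_nhds x hR))
      (isOpen_compl_singleton.mem_nhds hxz), fun q hq => hRΩ hq.1.2, ?_⟩
    have hvt : Set.EqOn m (vortex α z) (D ∩ (t ∩ ball x R ∩ {z}ᶜ)) := fun q hq =>
      hv ⟨⟨hq.1, hq.2.1.2⟩, hq.2.2⟩
    intro p hp q hq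
    rw [hvt hp, hvt hq]
    exact hK hp.2.1.1 hq.2.1.1
  · refine ⟨_, ball x (R / 4), ball_mem_nhds x (by positivity),
      (ball_subset_ball (by linarith)).trans hRΩ,
      (HB.lipschitzOnWith_of_forall_not_crosses hR hX).mono ?_⟩
    exact fun q hq => ⟨⟨hq.1, ball_subset_ball (by linarith) hq.2⟩, hq.2⟩

theorem exists_lipschitzWith_extendFrom (H : IsCharacteristicField Ω D m) {x : Plane} (hx : x ∈ Ω)
    (hxS : x ∉ vortexSet Ω D m) : ∃ K, ∃ t ∈ 𝓝 x, ∃ g : Plane → Plane, LipschitzWith K g ∧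
      Set.EqOn (extendFrom D m) g t ∧ Set.EqOn m g (D ∩ t) := by
  obtain ⟨K, t, ht, htΩ, hK⟩ := H.exists_lipschitzOnWith hx hxS
  obtain ⟨g, hg, hgm⟩ := hK.extend_finite_dimension
  refine ⟨_, interior t, interior_mem_nhds.2 ht, g, hg, fun y hy => ?_,
    hgm.mono (by gcongr; exact interior_subset)⟩
  refine extendFrom_eq (H.dense (htΩ (interior_subset hy)))
    ((hg.continuous.tendsto y |>.mono_left nhdsWithin_le_nhds).congr' ?_)
  filter_upwards [self_mem_nhdsWithin, nhdsWithin_le_nhds (mem_interior_iff_mem_nhds.1 hy)]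
    with q hqD hqt using (hgm ⟨hqD, hqt⟩).symm

theorem eqOn_extendFrom (H : IsCharacteristicField Ω D m) : Set.EqOn (extendFrom D m) m D := by
  intro x hx
  obtain ⟨K, t, ht, g, -, heq, hm⟩ :=
    H.exists_lipschitzWith_extendFrom (H.subset hx) (H.notMem_vortexSet hx)
  rw [heq (mem_of_mem_nhds ht), hm ⟨hx, mem_of_mem_nhds ht⟩]

theorem locallyLipschitzOn_extendFrom (H : IsCharacteristicField Ω D m) :
    LocallyLipschitzOn (Ω \ vortexSet Ω D m) (extendFrom D m) := by
  rintro x ⟨hx, hxS⟩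
  obtain ⟨K, t, ht, g, hg, heq, -⟩ := H.exists_lipschitzWith_extendFrom hx hxS
  refine ⟨K, t, nhdsWithin_le_nhds ht, fun p hp q hq => ?_⟩
  rw [heq hp, heq hq]
  exact hg p q

theorem eqOn_extendFrom_vortex (H : IsCharacteristicField Ω D m) {P : Plane}
    (hP : P ∈ vortexSet Ω D m) : ∃ α : ℝ, (α = 1 ∨ α = -1) ∧ ∀ U ∈ 𝓝 P, Convex ℝ U → U ⊆ Ω →
      Set.EqOn (extendFrom D m) (vortex α P) (U \ {P}) := by
  obtain ⟨α, hα, hv⟩ := H.exists_eqOn_vortex hP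
  refine ⟨α, hα, fun U hUP hc hUΩ => ?_⟩
  have hPI : P ∈ interior U := mem_interior_iff_mem_nhds.2 hUP
  have hIΩ : interior U ⊆ Ω := interior_subset.trans hUΩ
  have hUI : U ⊆ closure (interior U) := by
    rw [hc.closure_interior_eq_closure_of_nonempty_interior ⟨P, hPI⟩]
    exact subset_closure
  have hdense : U \ {P} ⊆ closure ((D ∩ interior U) \ {P}) := by
    intro x hx
    refine closure_minimal ?_ isClosed_closure (isOpen_compl_singleton.closure_inter
      ⟨hUI hx.1, hx.2⟩)
    intro q hq
    exact isOpen_compl_singleton.closure_inter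
      ⟨(H.restrict isOpen_interior hIΩ).dense hq.1, hq.2⟩
  have hS : U \ {P} ⊆ Ω \ vortexSet Ω D m := fun x hx =>
    ⟨hUΩ hx.1, fun hxS => hx.2 (H.eq_of_mem_vortexSet hP hxS isOpen_interior hc.interior hIΩ hPI
      (hUI hx.1)).symm⟩
  have hcont : ContinuousOn (vortex α P) (U \ {P}) := fun x hx =>
    (contDiffAt_vortex (n := 0) α hx.2).continuousAt.continuousWithinAt
  refine Set.EqOn.of_subset_closure (fun x hx => ?_)
    (H.locallyLipschitzOn_extendFrom.continuousOn.mono hS) hcont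
    (Set.sdiff_subset_sdiff_left (Set.inter_subset_right.trans interior_subset)) hdense
  rw [H.eqOn_extendFrom hx.1.1, hv _ isOpen_interior hc.interior hIΩ hPI hx]

end IsCharacteristicField
end VortexSet

section Mollifier

variable {E : Type*} [NormedAddCommGroup E] [MeasureSpace E]

/-- The mollification `f * ρ` of `f` by the kernel `ρ`. -/
noncomputable def mollify (ρ f : E → ℝ) (x : E) : ℝ := ∫ y, f y * ρ (x - y)

theorem mollify_const_mul (ρ f : E → ℝ) (c : ℝ) (x : E) :
    mollify ρ (fun y => c * f y) x = c * mollify ρ f x := by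
  simp only [mollify, mul_assoc, integral_const_mul]

theorem locallyIntegrable_of_abs_le [IsLocallyFiniteMeasure (volume : Measure E)]
    {f : E → ℝ} {B : ℝ} (hf : Measurable f) (hB : ∀ x, |f x| ≤ B) : LocallyIntegrable f :=
  (locallyIntegrable_const B).mono hf.aestronglyMeasurable
    (.of_forall fun x => (hB x).trans (le_abs_self B))

theorem abs_integral_mul_comp_sub_le {g k : E → ℝ} {x : E} {ε M : ℝ}
    (hg : IntegrableOn g (closedBall x ε)) (hk : ∀ z, |k z| ≤ M)
    (hsupp : ∀ y ∉ closedBall x ε, k (x - y) = 0) :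
    |∫ y, g y * k (x - y)| ≤ M * ∫ y in closedBall x ε, |g y| := by
  rw [← setIntegral_eq_integral_of_forall_compl_eq_zero (s := closedBall x ε)
    (fun y hy => by rw [hsupp y hy, mul_zero]), ← integral_const_mul, ← Real.norm_eq_abs]
  refine norm_integral_le_of_norm_le (hg.abs.const_mul M) (.of_forall fun y => ?_)
  rw [norm_mul, Real.norm_eq_abs, Real.norm_eq_abs, mul_comm]
  exact mul_le_mul_of_nonneg_right (hk _) (abs_nonneg _)

theorem mollify_eq_convolution (ρ f : E → ℝ) :
    mollify ρ f = convolution f ρ (ContinuousLinearMap.mul ℝ ℝ) volume := rfl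

variable [NormedSpace ℝ E]

/-- `ρ` is a smooth mollifier at scale `ε`, with `ρ` and its gradient bounded by the constant `C`
times the natural powers of `ε`. -/
structure IsMollifier (C ε : ℝ) (ρ : E → ℝ) : Prop where
  pos : 0 < ε
  smooth : ContDiff ℝ ∞ ρ
  nonneg : ∀ x, 0 ≤ ρ x
  tsupport_subset : tsupport ρ ⊆ closedBall 0 ε
  integral_eq_one : ∫ x, ρ x = 1
  le : ∀ x, ρ x ≤ C / ε ^ Module.finrank ℝ E
  norm_fderiv_le : ∀ x, ‖fderiv ℝ ρ x‖ ≤ C / ε ^ (Module.finrank ℝ E + 1)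

namespace IsMollifier

variable {C ε : ℝ} {ρ f g : E → ℝ} {x y : E}

theorem const_nonneg (h : IsMollifier C ε ρ) : 0 ≤ C := by
  have hdiv : 0 ≤ C / ε ^ Module.finrank ℝ E := (h.nonneg 0).trans (h.le 0)
  rwa [le_div_iff₀ (pow_pos h.pos _), zero_mul] at hdiv

theorem sub_notMem_tsupport (h : IsMollifier C ε ρ) (hy : y ∉ closedBall x ε) :
    x - y ∉ tsupport ρ := fun hmem => by
  refine hy ?_
  rw [mem_closedBall_iff_norm']
  exact mem_closedBall_zero_iff.1 (h.tsupport_subset hmem)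

theorem eq_zero_of_notMem (h : IsMollifier C ε ρ) (hy : y ∉ closedBall x ε) : ρ (x - y) = 0 :=
  image_eq_zero_of_notMem_tsupport (h.sub_notMem_tsupport hy)

theorem fderiv_eq_zero_of_notMem (h : IsMollifier C ε ρ) (hy : y ∉ closedBall x ε) :
    fderiv ℝ ρ (x - y) = 0 :=
  image_eq_zero_of_notMem_tsupport fun hmem =>
    h.sub_notMem_tsupport hy (tsupport_fderiv_subset ℝ hmem)

theorem fderiv_comp_sub (h : IsMollifier C ε ρ) (x y v : E) :
    fderiv ℝ (fun y => ρ (x - y)) y v = -fderiv ℝ ρ (x - y) v := by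
  have hd : HasFDerivAt (fun y => ρ (x - y))
      ((fderiv ℝ ρ (x - y)).comp (-ContinuousLinearMap.id ℝ E)) y :=
    HasFDerivAt.comp y (h.smooth.differentiable (by simp) _).hasFDerivAt
      ((hasFDerivAt_id y).const_sub x)
  simp [hd.fderiv]

theorem abs_mollify_le (h : IsMollifier C ε ρ) (hf : IntegrableOn f (closedBall x ε)) :
    |mollify ρ f x| ≤ C / ε ^ Module.finrank ℝ E * ∫ y in closedBall x ε, |f y| :=
  abs_integral_mul_comp_sub_le hf (fun z => (abs_of_nonneg (h.nonneg z)).trans_le (h.le z))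
    fun _ hy => h.eq_zero_of_notMem hy

variable [FiniteDimensional ℝ E]

theorem hasCompactSupport (h : IsMollifier C ε ρ) : HasCompactSupport ρ :=
  HasCompactSupport.of_support_subset_isCompact (isCompact_closedBall 0 ε)
    ((subset_tsupport ρ).trans h.tsupport_subset)

variable [BorelSpace E]

theorem integrable_mul_comp_sub (h : IsMollifier C ε ρ) (hf : LocallyIntegrable f) (x : E) :
    Integrable fun y => f y * ρ (x - y) :=
  h.hasCompactSupport.convolutionExists_right (ContinuousLinearMap.mul ℝ ℝ) hf
    h.smooth.continuous x

theorem integrable_mul_fderiv_comp_sub (h : IsMollifier C ε ρ) (hf : LocallyIntegrable f)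
    (x v : E) : Integrable fun y => f y * fderiv ℝ ρ (x - y) v :=
  (h.hasCompactSupport.fderiv_apply ℝ v).convolutionExists_right (ContinuousLinearMap.mul ℝ ℝ) hf
    ((h.smooth.continuous_fderiv (by simp)).clm_apply continuous_const) x

theorem mollify_add (h : IsMollifier C ε ρ) (hf : LocallyIntegrable f) (hg : LocallyIntegrable g)
    (x : E) : mollify ρ (fun y => f y + g y) x = mollify ρ f x + mollify ρ g x := by
  simp only [mollify, add_mul]
  exact integral_add (h.integrable_mul_comp_sub hf x) (h.integrable_mul_comp_sub hg x)

theorem mollify_mono (h : IsMollifier C ε ρ) (hf : LocallyIntegrable f) (hg : LocallyIntegrable g)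
    (hfg : ∀ y, f y ≤ g y) (x : E) : mollify ρ f x ≤ mollify ρ g x :=
  integral_mono (h.integrable_mul_comp_sub hf x) (h.integrable_mul_comp_sub hg x)
    fun y => mul_le_mul_of_nonneg_right (hfg y) (h.nonneg _)

theorem contDiff_mollify (h : IsMollifier C ε ρ) (hf : LocallyIntegrable f) :
    ContDiff ℝ ∞ (mollify ρ f) :=
  h.hasCompactSupport.contDiff_convolution_right (ContinuousLinearMap.mul ℝ ℝ) hf h.smooth

variable [(volume : Measure E).IsAddHaarMeasure]

theorem fderiv_mollify (h : IsMollifier C ε ρ) (hf : LocallyIntegrable f) (x v : E) :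
    fderiv ℝ (mollify ρ f) x v = ∫ y, f y * fderiv ℝ ρ (x - y) v := by
  rw [mollify_eq_convolution, (h.hasCompactSupport.hasFDerivAt_convolution_right
      (ContinuousLinearMap.mul ℝ ℝ) hf (h.smooth.of_le (by simp)) x).fderiv,
    convolution_precompR_apply _ hf (h.hasCompactSupport.fderiv ℝ)
      (h.smooth.continuous_fderiv (by simp))]
  rfl

theorem integral_comp_sub (h : IsMollifier C ε ρ) (x : E) : ∫ y, ρ (x - y) = 1 := by
  rw [integral_sub_left_eq_self ρ volume x, h.integral_eq_one]

theorem mollify_const (h : IsMollifier C ε ρ) (c : ℝ) (x : E) : mollify ρ (fun _ => c) x = c := by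
  rw [mollify, integral_const_mul, h.integral_comp_sub, mul_one]

theorem mollify_sub_const (h : IsMollifier C ε ρ) (hf : LocallyIntegrable f) (c : ℝ) (x : E) :
    mollify ρ (fun y => f y - c) x = mollify ρ f x - c := by
  simp only [sub_eq_add_neg]
  rw [h.mollify_add hf (locallyIntegrable_const _), h.mollify_const]

theorem abs_mollify_sub_le (h : IsMollifier C ε ρ) (hf : LocallyIntegrable f) (c : ℝ) (x : E) :
    |mollify ρ f x - c| ≤ C / ε ^ Module.finrank ℝ E * ∫ y in closedBall x ε, |f y - c| := by
  rw [← h.mollify_sub_const hf]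
  exact h.abs_mollify_le ((hf.sub (locallyIntegrable_const c)).integrableOn_isCompact
    (isCompact_closedBall x ε))

theorem abs_fderiv_mollify_le (h : IsMollifier C ε ρ) (hf : LocallyIntegrable f) (c : ℝ)
    (x v : E) : |fderiv ℝ (mollify ρ f) x v| ≤
      C / ε ^ (Module.finrank ℝ E + 1) * ‖v‖ * ∫ y in closedBall x ε, |f y - c| := by
  have hfc : LocallyIntegrable fun y => f y - c := hf.sub (locallyIntegrable_const c)
  have hsub : (mollify ρ fun y => f y - c) = fun x => mollify ρ f x - c :=
    funext fun x => h.mollify_sub_const hf c x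
  rw [← fderiv_sub_const c, ← hsub, h.fderiv_mollify hfc]
  refine abs_integral_mul_comp_sub_le (k := fun z => fderiv ℝ ρ z v)
    (hfc.integrableOn_isCompact (isCompact_closedBall x ε)) (fun z => ?_) fun y hy => by
      rw [h.fderiv_eq_zero_of_notMem hy, zero_apply]
  exact (fderiv ℝ ρ z).le_of_opNorm_le (h.norm_fderiv_le z) v

theorem mollify_sq_sub_add_sq_sub (h : IsMollifier C ε ρ) (hf : LocallyIntegrable f)
    (hg : LocallyIntegrable g) (hfg : ∀ y, f y ^ 2 + g y ^ 2 = 1) (c d : ℝ) (x : E) :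
    mollify ρ (fun y => (f y - c) ^ 2 + (g y - d) ^ 2) x =
      (1 - mollify ρ f x ^ 2 - mollify ρ g x ^ 2) + (mollify ρ f x - c) ^ 2
        + (mollify ρ g x - d) ^ 2 := by
  have hexpand : (fun y => (f y - c) ^ 2 + (g y - d) ^ 2) =
      fun y => (1 + c ^ 2 + d ^ 2) + ((-2 * c) * f y + (-2 * d) * g y) := by
    funext y
    linear_combination hfg y
  have hf' : LocallyIntegrable fun y => (-2 * c) * f y := hf.smul (-2 * c)
  have hg' : LocallyIntegrable fun y => (-2 * d) * g y := hg.smul (-2 * d)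
  have hfg' : LocallyIntegrable fun y => (-2 * c) * f y + (-2 * d) * g y := hf'.add hg'
  rw [hexpand, h.mollify_add (locallyIntegrable_const _) hfg', h.mollify_add hf' hg',
    h.mollify_const, mollify_const_mul, mollify_const_mul]
  ring

theorem mollify_sq_add_mollify_sq_le_one (h : IsMollifier C ε ρ) (hf : LocallyIntegrable f)
    (hg : LocallyIntegrable g) (hfg : ∀ y, f y ^ 2 + g y ^ 2 = 1) (x : E) :
    mollify ρ f x ^ 2 + mollify ρ g x ^ 2 ≤ 1 := by
  have hvar := h.mollify_sq_sub_add_sq_sub hf hg hfg (mollify ρ f x) (mollify ρ g x) x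
  have hvar_nonneg : 0 ≤ mollify ρ
      (fun y => (f y - mollify ρ f x) ^ 2 + (g y - mollify ρ g x) ^ 2) x :=
    integral_nonneg fun y => mul_nonneg (by positivity) (h.nonneg _)
  linarith

theorem one_sub_mollify_sq_le (h : IsMollifier C ε ρ) (hf : LocallyIntegrable f)
    (hg : LocallyIntegrable g) (hfg : ∀ y, f y ^ 2 + g y ^ 2 = 1) (c d : ℝ)
    (hint : IntegrableOn (fun y => (f y - c) ^ 2 + (g y - d) ^ 2) (closedBall x ε)) :
    1 - mollify ρ f x ^ 2 - mollify ρ g x ^ 2 ≤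
      C / ε ^ Module.finrank ℝ E * ∫ y in closedBall x ε, ((f y - c) ^ 2 + (g y - d) ^ 2) := by
  have hle := (le_abs_self _).trans (h.abs_mollify_le hint)
  simp only [abs_of_nonneg (add_nonneg (sq_nonneg (f _ - c)) (sq_nonneg (g _ - d)))] at hle
  rw [h.mollify_sq_sub_add_sq_sub hf hg hfg] at hle
  linarith [sq_nonneg (mollify ρ f x - c), sq_nonneg (mollify ρ g x - d)]

theorem rescale (h : IsMollifier C 1 ρ) (hε : 0 < ε) :
    IsMollifier C ε fun x => (ε ^ Module.finrank ℝ E)⁻¹ * ρ (ε⁻¹ • x) where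
  pos := hε
  smooth := contDiff_const.mul (h.smooth.comp (contDiff_const_smul ε⁻¹))
  nonneg x := mul_nonneg (by positivity) (h.nonneg _)
  tsupport_subset := by
    refine closure_minimal (fun x hx => ?_) isClosed_closedBall
    have hmem := h.tsupport_subset (subset_tsupport ρ (right_ne_zero_of_mul hx))
    rw [mem_closedBall_zero_iff, norm_smul, norm_inv, Real.norm_of_nonneg hε.le,
      inv_mul_le_iff₀ hε, mul_one] at hmem
    exact mem_closedBall_zero_iff.2 hmem
  integral_eq_one := by
    rw [integral_const_mul, Measure.integral_comp_inv_smul_of_nonneg _ _ hε.le, h.integral_eq_one,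
      smul_eq_mul, mul_one, inv_mul_cancel₀ (pow_ne_zero _ hε.ne')]
  le x := by
    have hle : ρ (ε⁻¹ • x) ≤ C := by simpa using h.le (ε⁻¹ • x)
    rw [div_eq_inv_mul]
    gcongr
  norm_fderiv_le x := by
    have hle : ‖fderiv ℝ ρ (ε⁻¹ • x)‖ ≤ C := by simpa using h.norm_fderiv_le (ε⁻¹ • x)
    have hdiff : DifferentiableAt ℝ (fun x => ρ (ε⁻¹ • x)) x :=
      (h.smooth.comp (contDiff_const_smul ε⁻¹)).differentiable (by simp) x
    rw [fderiv_const_mul hdiff, fderiv_comp_smul, norm_smul, norm_smul, norm_inv, norm_inv,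
      norm_pow, Real.norm_of_nonneg hε.le, div_eq_inv_mul, pow_succ, mul_inv, mul_assoc]
    gcongr

end IsMollifier

variable [BorelSpace E] [FiniteDimensional ℝ E] [(volume : Measure E).IsAddHaarMeasure]

variable (E) in
theorem exists_isMollifier_one : ∃ (C : ℝ) (ρ : E → ℝ), IsMollifier C 1 ρ := by
  let φ : ContDiffBump (0 : E) := ⟨1 / 2, 1, by norm_num, by norm_num⟩
  have hcs : HasCompactSupport (φ.normed volume) := φ.hasCompactSupport_normed
  have hd : Continuous (fderiv ℝ (φ.normed volume)) :=
    φ.contDiff_normed.continuous_fderiv one_ne_zero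
  obtain ⟨A, hA⟩ := φ.continuous_normed.bounded_above_of_compact_support hcs
  obtain ⟨B, hB⟩ := hd.bounded_above_of_compact_support (hcs.fderiv ℝ)
  refine ⟨max A B, φ.normed volume, one_pos, φ.contDiff_normed, φ.nonneg_normed,
    φ.tsupport_normed_eq.subset, φ.integral_normed, fun x => ?_, fun x => ?_⟩
  · rw [one_pow, div_one]
    exact (le_abs_self _).trans ((hA x).trans (le_max_left A B))
  · rw [one_pow, div_one]
    exact (hB x).trans (le_max_right A B)

/-- A sequence of mollifiers with a common constant whose scales tend to `0`. -/
structure IsApproximateIdentity (C : ℝ) (ε : ℕ → ℝ) (ρ : ℕ → E → ℝ) : Prop where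
  isMollifier : ∀ n, IsMollifier C (ε n) (ρ n)
  tendsto_zero : Tendsto ε atTop (𝓝 0)

variable (E) in
theorem exists_isApproximateIdentity :
    ∃ (C : ℝ) (ε : ℕ → ℝ) (ρ : ℕ → E → ℝ), IsApproximateIdentity C ε ρ := by
  obtain ⟨C, ρ, hρ⟩ := exists_isMollifier_one E
  exact ⟨C, _, _, fun n => hρ.rescale Nat.one_div_pos_of_nat,
    tendsto_one_div_add_atTop_nhds_zero_nat⟩

end Mollifier

theorem IsMollifier.isTestFunction {C ε : ℝ} {ρ : Plane → ℝ} {Ω : Set Plane} {x : Plane}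
    (h : IsMollifier C ε ρ) (hx : closedBall x ε ⊆ Ω) : IsTestFunction Ω fun y => ρ (x - y) := by
  have hsupp : Function.support (fun y => ρ (x - y)) ⊆ closedBall x ε :=
    Function.support_subset_iff'.2 fun y hy => h.eq_zero_of_notMem hy
  exact ⟨h.smooth.comp (contDiff_const.sub contDiff_id),
    HasCompactSupport.of_support_subset_isCompact (isCompact_closedBall x ε) hsupp,
    (closure_minimal hsupp isClosed_closedBall).trans hx⟩

theorem integral_sq_mul_integral_le {α : Type*} [MeasurableSpace α] {μ : Measure α}
    [IsFiniteMeasure μ] {f : α → ℝ} (hf : MemLp f 3 μ) (hf0 : ∀ y, 0 ≤ f y) :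
    (∫ y, f y ^ 2 ∂μ) * ∫ y, f y ∂μ ≤ μ.real Set.univ * ∫ y, f y ^ 3 ∂μ := by
  have hint : Integrable f μ := hf.integrable (by norm_num)
  have hint2 : Integrable (fun y => f y ^ 2) μ := (hf.mono_exponent (by norm_num)).integrable_sq
  have hint3 : Integrable (fun y => f y ^ 3) μ := by
    simpa only [Real.norm_of_nonneg (hf0 _)] using hf.integrable_norm_pow three_ne_zero
  have hcubes : ∀ s t : ℝ, 0 ≤ s → 0 ≤ t → t * s ^ 2 + t ^ 2 * s ≤ s ^ 3 + t ^ 3 :=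
    fun s t hs ht => by nlinarith [mul_nonneg (sq_nonneg (s - t)) (add_nonneg hs ht)]
  have hinner : ∀ t, 0 ≤ t → (∫ y, f y ^ 2 ∂μ) * t + (∫ y, f y ∂μ) * t ^ 2
      ≤ ∫ y, f y ^ 3 ∂μ + μ.real Set.univ * t ^ 3 := fun t ht => by
    have hmono := integral_mono ((hint2.const_mul t).add (hint.const_mul (t ^ 2)))
      (hint3.add (integrable_const (t ^ 3))) fun y => hcubes (f y) t (hf0 y) ht
    simp only [Pi.add_apply] at hmono
    rwa [integral_add (hint2.const_mul t) (hint.const_mul _), integral_add hint3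
      (integrable_const _), integral_const_mul, integral_const_mul, integral_const, smul_eq_mul,
      mul_comm t, mul_comm (t ^ 2)] at hmono
  have houter := integral_mono ((hint.const_mul _).add (hint2.const_mul _))
    ((integrable_const _).add (hint3.const_mul _)) fun t => hinner (f t) (hf0 t)
  simp only [Pi.add_apply] at houter
  rw [integral_add (hint.const_mul _) (hint2.const_mul _), integral_add (integrable_const _)
    (hint3.const_mul _), integral_const_mul, integral_const_mul, integral_const_mul,
    integral_const, smul_eq_mul] at houter
  linarith

theorem pow_three_le_mul_rpow {p t : ℝ} (hp : p ≤ 3) (ht0 : 0 ≤ t) (ht2 : t ≤ 2) (hp0 : 0 ≤ p) :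
    t ^ 3 ≤ 2 ^ (3 - p) * t ^ p := by
  have hsplit : t ^ 3 = t ^ (3 - p) * t ^ p := by
    rw [← Real.rpow_add_of_nonneg ht0 (sub_nonneg.2 hp) hp0, sub_add_cancel]
    exact (Real.rpow_natCast t 3).symm
  rw [hsplit]
  exact mul_le_mul_of_nonneg_right (Real.rpow_le_rpow ht0 ht2 (sub_nonneg.2 hp))
    (Real.rpow_nonneg ht0 p)

/-- Measurable planar fields of unit length. -/
structure IsUnitField (u : Plane → Plane) : Prop where
  measurable : Measurable u
  norm_eq_one : ∀ x, ‖u x‖ = 1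

/-- The component of the field `u` in the direction `ξ`. -/
noncomputable def component (ξ : Plane) (u : Plane → Plane) (y : Plane) : ℝ := ⟪ξ, u y⟫

/-- The defect `1 - |u * ρ|²` of a mollified unit field, written in the frame `ξ, ξ^⊥`. -/
noncomputable def defect (ρ : Plane → ℝ) (ξ : Plane) (u : Plane → Plane) (x : Plane) : ℝ :=
  1 - mollify ρ (component ξ u) x ^ 2 - mollify ρ (component (perp ξ) u) x ^ 2

theorem defect_le_one (ρ : Plane → ℝ) (ξ : Plane) (u : Plane → Plane) (x : Plane) :
    defect ρ ξ u x ≤ 1 := by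
  unfold defect
  linarith [sq_nonneg (mollify ρ (component ξ u) x),
    sq_nonneg (mollify ρ (component (perp ξ) u) x)]

theorem inner_sq_add_inner_perp_sq {ξ : Plane} (hξ : ‖ξ‖ = 1) (e : Plane) :
    ⟪ξ, e⟫ ^ 2 + ⟪perp ξ, e⟫ ^ 2 = ‖e‖ ^ 2 := by
  rw [inner_perp, inner_sq_add_wedge_sq, hξ, one_pow, one_mul]

namespace IsUnitField

variable {u : Plane → Plane} {ξ : Plane}

theorem measurable_component (hu : IsUnitField u) (ξ : Plane) : Measurable (component ξ u) :=
  measurable_const.inner hu.measurable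

theorem abs_component_le (hu : IsUnitField u) (ξ y : Plane) : |component ξ u y| ≤ ‖ξ‖ := by
  simpa only [component, hu.norm_eq_one, mul_one] using abs_real_inner_le_norm ξ (u y)

theorem locallyIntegrable_component (hu : IsUnitField u) (ξ : Plane) :
    LocallyIntegrable (component ξ u) :=
  locallyIntegrable_of_abs_le (hu.measurable_component ξ) (hu.abs_component_le ξ)

theorem component_sq_add_sq (hu : IsUnitField u) (hξ : ‖ξ‖ = 1) (y : Plane) :
    component ξ u y ^ 2 + component (perp ξ) u y ^ 2 = 1 := by
  rw [component, component, inner_sq_add_inner_perp_sq hξ, hu.norm_eq_one, one_pow]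

theorem norm_sub_le_two (hu : IsUnitField u) (x y : Plane) : ‖u y - u x‖ ≤ 2 := by
  have htri := norm_sub_le (u y) (u x)
  rw [hu.norm_eq_one, hu.norm_eq_one] at htri
  linarith

theorem memLp_norm_sub (hu : IsUnitField u) (x : Plane) (ε : ℝ) (q : ENNReal) :
    MemLp (fun y => ‖u y - u x‖) q (volume.restrict (closedBall x ε)) :=
  haveI : IsFiniteMeasure (volume.restrict (closedBall x ε)) :=
    isFiniteMeasure_restrict.2 measure_closedBall_lt_top.ne
  .of_bound (hu.measurable.sub_const _).norm.aestronglyMeasurable 2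
    (.of_forall fun y => (norm_norm _).trans_le (hu.norm_sub_le_two x y))

theorem integrableOn_norm_sub_pow (hu : IsUnitField u) (x : Plane) (ε : ℝ) {k : ℕ} (hk : k ≠ 0) :
    IntegrableOn (fun y => ‖u y - u x‖ ^ k) (closedBall x ε) := by
  simpa only [norm_norm, IntegrableOn] using (hu.memLp_norm_sub x ε k).integrable_norm_pow hk

variable {C ε : ℝ} {ρ : Plane → ℝ}

theorem defect_nonneg (hu : IsUnitField u) (h : IsMollifier C ε ρ) (hξ : ‖ξ‖ = 1) (x : Plane) :
    0 ≤ defect ρ ξ u x := by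
  have hle := h.mollify_sq_add_mollify_sq_le_one (hu.locallyIntegrable_component ξ)
    (hu.locallyIntegrable_component (perp ξ)) (hu.component_sq_add_sq hξ) x
  unfold defect
  linarith

theorem defect_le (hu : IsUnitField u) (h : IsMollifier C ε ρ) (hξ : ‖ξ‖ = 1) (x : Plane) :
    defect ρ ξ u x ≤ C / ε ^ 2 * ∫ y in closedBall x ε, ‖u y - u x‖ ^ 2 := by
  have hsq : ∀ y, (component ξ u y - component ξ u x) ^ 2
      + (component (perp ξ) u y - component (perp ξ) u x) ^ 2 = ‖u y - u x‖ ^ 2 := fun y => by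
    simp only [component, ← inner_sub_right, inner_sq_add_inner_perp_sq hξ]
  have hle := h.one_sub_mollify_sq_le (hu.locallyIntegrable_component ξ)
    (hu.locallyIntegrable_component (perp ξ)) (hu.component_sq_add_sq hξ) (x := x)
    (component ξ u x) (component (perp ξ) u x)
  simp only [hsq, finrank_euclideanSpace_fin] at hle
  exact hle (hu.integrableOn_norm_sub_pow x ε two_ne_zero)

theorem abs_fderiv_mollify_component_le (hu : IsUnitField u) (h : IsMollifier C ε ρ)
    (hξ : ‖ξ‖ = 1) (x v : Plane) : |fderiv ℝ (mollify ρ (component ξ u)) x v| ≤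
      C / ε ^ 3 * ‖v‖ * ∫ y in closedBall x ε, ‖u y - u x‖ := by
  have hε := h.pos
  have hC := h.const_nonneg
  have hlip : ∀ y, |component ξ u y - component ξ u x| ≤ ‖u y - u x‖ := fun y => by
    simpa only [component, ← inner_sub_right, hξ, one_mul] using
      abs_real_inner_le_norm ξ (u y - u x)
  have hle := h.abs_fderiv_mollify_le (hu.locallyIntegrable_component ξ) (component ξ u x) x v
  rw [finrank_euclideanSpace_fin] at hle
  refine hle.trans (mul_le_mul_of_nonneg_left (integral_mono ?_ ?_ hlip) (by positivity))
  · exact (((hu.locallyIntegrable_component ξ).sub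
      (locallyIntegrable_const _)).integrableOn_isCompact (isCompact_closedBall x ε)).abs
  · exact memLp_one_iff_integrable.1 (hu.memLp_norm_sub x ε 1)

theorem defect_mul_abs_fderiv_le (hu : IsUnitField u) (h : IsMollifier C ε ρ) (hξ : ‖ξ‖ = 1)
    (x v : Plane) : defect ρ ξ u x * |fderiv ℝ (mollify ρ (component ξ u)) x v| ≤
      Real.pi * C ^ 2 * ‖v‖ * ∫ y in closedBall x ε, ‖u y - u x‖ ^ 3 / ε ^ 3 := by
  have hε := h.pos
  have : IsFiniteMeasure (volume.restrict (closedBall x ε)) :=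
    isFiniteMeasure_restrict.2 measure_closedBall_lt_top.ne
  have hvol : (volume.restrict (closedBall x ε)).real Set.univ = Real.pi * ε ^ 2 := by
    rw [measureReal_restrict_apply_univ, Measure.real, EuclideanSpace.volume_closedBall_fin_two,
      ENNReal.toReal_mul, ENNReal.toReal_pow, ENNReal.toReal_ofReal hε.le,
      ENNReal.toReal_ofReal Real.pi_pos.le, mul_comm]
  have hcheb := integral_sq_mul_integral_le (hu.memLp_norm_sub x ε 3) fun y => norm_nonneg _
  rw [hvol] at hcheb
  rw [integral_div]
  set I₁ := ∫ y in closedBall x ε, ‖u y - u x‖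
  set I₂ := ∫ y in closedBall x ε, ‖u y - u x‖ ^ 2
  set I₃ := ∫ y in closedBall x ε, ‖u y - u x‖ ^ 3
  have hdefect : defect ρ ξ u x ≤ C / ε ^ 2 * I₂ := hu.defect_le h hξ x
  calc defect ρ ξ u x * |fderiv ℝ (mollify ρ (component ξ u)) x v|
      ≤ (C / ε ^ 2 * I₂) * (C / ε ^ 3 * ‖v‖ * I₁) :=
        mul_le_mul hdefect (hu.abs_fderiv_mollify_component_le h hξ x v) (abs_nonneg _)
          ((hu.defect_nonneg h hξ x).trans hdefect)
    _ = C ^ 2 * ‖v‖ / ε ^ 5 * (I₂ * I₁) := by field_simp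
    _ ≤ C ^ 2 * ‖v‖ / ε ^ 5 * (Real.pi * ε ^ 2 * I₃) := by gcongr
    _ = Real.pi * C ^ 2 * ‖v‖ * (I₃ / ε ^ 3) := by field_simp

end IsUnitField

/-- The integrand of the Gagliardo seminorm of order `1 / p`, for which `2 + s * p = 3`. -/
noncomputable def gagliardoKernel (p : ℝ) (u : Plane → Plane) (x y : Plane) : ENNReal :=
  ENNReal.ofReal (‖u x - u y‖ ^ p / ‖x - y‖ ^ (3 : ℝ))

theorem gagliardoKernel_self {p : ℝ} (hp : p ≠ 0) (u : Plane → Plane) (x : Plane) :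
    gagliardoKernel p u x x = 0 := by
  rw [gagliardoKernel, sub_self, sub_self, norm_zero, Real.zero_rpow hp, zero_div,
    ENNReal.ofReal_zero]

theorem measurable_gagliardoKernel (p : ℝ) {u : Plane → Plane} (hu : Measurable u) :
    Measurable fun z : Plane × Plane => gagliardoKernel p u z.1 z.2 :=
  ENNReal.measurable_ofReal.comp
    (((((hu.comp measurable_fst).sub (hu.comp measurable_snd)).norm).pow_const p).div
      (((measurable_fst.sub measurable_snd).norm).pow_const _))

namespace IsUnitField

variable {p C ε : ℝ} {u : Plane → Plane} {ρ : Plane → ℝ} {ξ : Plane}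

theorem ofReal_norm_sub_pow_three_div_le (hu : IsUnitField u) (hp : p ∈ Set.Icc (1 : ℝ) 3)
    {x y : Plane} (hxy : y ∈ closedBall x ε) :
    ENNReal.ofReal (‖u y - u x‖ ^ 3 / ε ^ 3) ≤
      ENNReal.ofReal (2 ^ (3 - p)) * gagliardoKernel p u x y := by
  rcases eq_or_ne x y with rfl | hne
  · simp
  have hpos : 0 < ‖x - y‖ := norm_pos_iff.2 (sub_ne_zero.2 hne)
  have hle : ‖x - y‖ ≤ ε := mem_closedBall_iff_norm'.1 hxy
  have hcube := pow_three_le_mul_rpow hp.2 (norm_nonneg (u x - u y)) (hu.norm_sub_le_two y x)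
    (zero_le_one.trans hp.1)
  have hrpow : ‖x - y‖ ^ (3 : ℝ) = ‖x - y‖ ^ 3 := Real.rpow_natCast ‖x - y‖ 3
  rw [gagliardoKernel, ← ENNReal.ofReal_mul (by positivity), norm_sub_rev (u y), ← mul_div_assoc,
    hrpow]
  gcongr

theorem ofReal_defect_mul_abs_fderiv_le (hu : IsUnitField u) (hp : p ∈ Set.Icc (1 : ℝ) 3)
    (h : IsMollifier C ε ρ) (hξ : ‖ξ‖ = 1) (x v : Plane) :
    ENNReal.ofReal (defect ρ ξ u x * |fderiv ℝ (mollify ρ (component ξ u)) x v|) ≤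
      ENNReal.ofReal (Real.pi * C ^ 2 * ‖v‖ * 2 ^ (3 - p)) *
        ∫⁻ y in closedBall x ε, gagliardoKernel p u x y := by
  have hε := h.pos
  have hcubes : ENNReal.ofReal (∫ y in closedBall x ε, ‖u y - u x‖ ^ 3 / ε ^ 3) ≤
      ENNReal.ofReal (2 ^ (3 - p)) * ∫⁻ y in closedBall x ε, gagliardoKernel p u x y := by
    rw [ofReal_integral_eq_lintegral_ofReal
        ((hu.integrableOn_norm_sub_pow x ε three_ne_zero).div_const _)
        (.of_forall fun y => by positivity),
      ← lintegral_const_mul _ ((measurable_gagliardoKernel p hu.measurable).of_uncurry_left)]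
    exact setLIntegral_mono' measurableSet_closedBall fun y hy =>
      hu.ofReal_norm_sub_pow_three_div_le hp hy
  calc ENNReal.ofReal (defect ρ ξ u x * |fderiv ℝ (mollify ρ (component ξ u)) x v|)
      ≤ ENNReal.ofReal (Real.pi * C ^ 2 * ‖v‖)
          * ENNReal.ofReal (∫ y in closedBall x ε, ‖u y - u x‖ ^ 3 / ε ^ 3) := by
        rw [← ENNReal.ofReal_mul (by positivity)]
        exact ENNReal.ofReal_le_ofReal (hu.defect_mul_abs_fderiv_le h hξ x v)
    _ ≤ _ := by
        rw [ENNReal.ofReal_mul (q := 2 ^ (3 - p)) (by positivity), mul_assoc (ENNReal.ofReal _)]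
        gcongr

end IsUnitField

/-- For every mollification of the unit field `u`, the product of the defect and the gradient tends
to `0` in `L¹_loc(Ω)`. -/
def CommutatorVanishes (Ω : Set Plane) (u : Plane → Plane) : Prop :=
  ∀ ⦃C : ℝ⦄ ⦃ε : ℕ → ℝ⦄ ⦃ρ : ℕ → Plane → ℝ⦄, IsApproximateIdentity C ε ρ →
    ∀ ξ : Plane, ‖ξ‖ = 1 → ∀ v : Plane, ∀ K ⊆ Ω, IsCompact K →
    Tendsto (fun n => ∫⁻ x in K, ENNReal.ofReal (defect (ρ n) ξ u x *
      |fderiv ℝ (mollify (ρ n) (component ξ u)) x v|)) atTop (𝓝 0)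

theorem tendsto_lintegral_indicator_dist_le {X : Type*} [MetricSpace X] [MeasurableSpace X]
    [OpensMeasurableSpace X] [SecondCountableTopology X] {μ : Measure (X × X)}
    {g : X × X → ENNReal} (hg : Measurable g) (hint : ∫⁻ z, g z ∂μ ≠ ⊤) (hdiag : ∀ x, g (x, x) = 0)
    {ε : ℕ → ℝ} (hε : Tendsto ε atTop (𝓝 0)) :
    Tendsto (fun n => ∫⁻ z, {z : X × X | dist z.2 z.1 ≤ ε n}.indicator g z ∂μ) atTop (𝓝 0) := by
  have hmeas : ∀ n, MeasurableSet {z : X × X | dist z.2 z.1 ≤ ε n} := fun n =>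
    measurableSet_le (measurable_snd.dist measurable_fst) measurable_const
  rw [← lintegral_zero (μ := μ)]
  refine tendsto_lintegral_of_dominated_convergence g (fun n => hg.indicator (hmeas n))
    (fun n => .of_forall fun z => Set.indicator_le_self _ _ z) hint (.of_forall ?_)
  rintro ⟨x, y⟩
  refine tendsto_const_nhds.congr' ?_
  rcases eq_or_ne x y with rfl | hne
  · exact .of_forall fun n => (Set.indicator_apply_eq_zero.2 fun _ => hdiag x).symm
  · filter_upwards [hε.eventually (gt_mem_nhds (dist_pos.2 hne.symm))] with n hn
    exact (Set.indicator_of_notMem (s := {z : X × X | dist z.2 z.1 ≤ ε n}) hn.not_ge g).symm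

theorem IsUnitField.commutatorVanishes_of_gagliardo {Ω : Set Plane} {p : ℝ} {u : Plane → Plane}
    (hu : IsUnitField u) (hΩ : IsOpen Ω) (hp : p ∈ Set.Icc (1 : ℝ) 3)
    (hG : ∀ K : Set Plane, IsCompact K → K ⊆ Ω →
      ∫⁻ x in K, ∫⁻ y in K, gagliardoKernel p u x y < ⊤) : CommutatorVanishes Ω u := by
  intro C ε ρ hρ ξ hξ v K hKΩ hK
  obtain ⟨δ, hδ, hδΩ⟩ := hK.exists_cthickening_subset_open hΩ hKΩ
  have hKδ : IsCompact (cthickening δ K) := hK.cthickening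
  let g : Plane × Plane → ENNReal := fun z => gagliardoKernel p u z.1 z.2
  let near : ℕ → Set (Plane × Plane) := fun n => {z | dist z.2 z.1 ≤ ε n}
  let μ : Measure (Plane × Plane) := (volume.restrict K).prod (volume.restrict (cthickening δ K))
  have hg : Measurable g := measurable_gagliardoKernel p hu.measurable
  have hgnear : ∀ n, Measurable ((near n).indicator g) := fun n =>
    hg.indicator (measurableSet_le (measurable_snd.dist measurable_fst) measurable_const)
  have hfin : ∫⁻ z, g z ∂μ ≠ ⊤ := by
    rw [lintegral_prod _ hg.aemeasurable]
    exact ((lintegral_mono_set (self_subset_cthickening K)).trans_lt (hG _ hKδ hδΩ)).ne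
  have hlim : Tendsto (fun n => ENNReal.ofReal (Real.pi * C ^ 2 * ‖v‖ * 2 ^ (3 - p)) *
      ∫⁻ z, (near n).indicator g z ∂μ) atTop (𝓝 0) := by
    simpa only [mul_zero] using ENNReal.Tendsto.const_mul (tendsto_lintegral_indicator_dist_le hg
      hfin (gagliardoKernel_self (zero_lt_one.trans_le hp.1).ne' u) hρ.tendsto_zero)
      (.inr ENNReal.ofReal_ne_top)
  refine tendsto_of_tendsto_of_tendsto_of_le_of_le' tendsto_const_nhds hlim
    (.of_forall fun _ => zero_le) ?_
  filter_upwards [hρ.tendsto_zero.eventually (gt_mem_nhds hδ)] with n hn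
  rw [lintegral_prod _ (hgnear n).aemeasurable,
    ← lintegral_const_mul _ (hgnear n).lintegral_prod_right']
  refine setLIntegral_mono' hK.measurableSet fun x hx =>
    (hu.ofReal_defect_mul_abs_fderiv_le hp (hρ.isMollifier n) hξ x v).trans ?_
  have hball : closedBall x (ε n) ⊆ cthickening δ K :=
    (closedBall_subset_closedBall hn.le).trans (closedBall_subset_cthickening hx δ)
  refine mul_le_mul_right ?_ _
  calc ∫⁻ y in closedBall x (ε n), gagliardoKernel p u x y
      = ∫⁻ y in closedBall x (ε n), (near n).indicator g (x, y) :=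
        setLIntegral_congr_fun measurableSet_closedBall fun y hy =>
          (Set.indicator_of_mem (s := near n) (a := (x, y)) hy g).symm
    _ ≤ _ := lintegral_mono_set hball

section LebesguePoint

variable {E F : Type*} [NormedAddCommGroup E] [MeasureSpace E] [NormedAddCommGroup F]

/-- `x` is a Lebesgue point of `f`. The averages are taken over balls that need not be centred at
`x`, so that they can also probe `f` in a prescribed direction from `x`. -/
def IsLebesguePoint (f : E → F) (x : E) : Prop :=
  ∀ (w : ℕ → E) (δ : ℕ → ℝ), Tendsto δ atTop (𝓝[>] 0) →
    (∀ᶠ j in atTop, x ∈ closedBall (w j) (2 * δ j)) →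
    Tendsto (fun j => ⨍ y in closedBall (w j) (δ j), ‖f y - f x‖) atTop (𝓝 0)

variable [NormedSpace ℝ E] [FiniteDimensional ℝ E] [(volume : Measure E).IsAddHaarMeasure]

theorem IsLebesguePoint.of_norm_sub_le {G : Type*} [NormedAddCommGroup G] {f : E → F} {g : E → G}
    {x : E} {M : ℝ} (hx : IsLebesguePoint f x) (hf : LocallyIntegrable f)
    (hle : ∀ y, ‖g y - g x‖ ≤ M * ‖f y - f x‖) : IsLebesguePoint g x := by
  intro w δ hδ hw
  have hlim := (hx w δ hδ hw).const_mul M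
  rw [mul_zero] at hlim
  refine squeeze_zero (fun j => integral_nonneg fun y => norm_nonneg _) (fun j => ?_) hlim
  have hint : IntegrableOn (fun y => M * ‖f y - f x‖) (closedBall (w j) (δ j)) :=
    ((hf.sub (locallyIntegrable_const (f x))).integrableOn_isCompact
      (isCompact_closedBall _ _)).norm.const_mul M
  rw [setAverage_eq, setAverage_eq, smul_eq_mul, smul_eq_mul, mul_left_comm,
    ← integral_const_mul M]
  exact mul_le_mul_of_nonneg_left (integral_mono_of_nonneg (.of_forall fun y => norm_nonneg _) hint
    (.of_forall hle)) (inv_nonneg.2 measureReal_nonneg)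

variable [BorelSpace E]

theorem ae_isLebesguePoint {f : E → F} (hf : LocallyIntegrable f) : ∀ᵐ x, IsLebesguePoint f x := by
  filter_upwards [IsUnifLocDoublingMeasure.ae_tendsto_average_norm_sub volume hf 2] with x hx w δ
  exact hx w δ

theorem IsLebesguePoint.tendsto_const_div_mul_integral {f : E → F} {x : E}
    (hx : IsLebesguePoint f x) {ε : ℕ → ℝ} (hε : ∀ n, 0 < ε n) (hε0 : Tendsto ε atTop (𝓝 0))
    (C : ℝ) : Tendsto (fun n => C / ε n ^ Module.finrank ℝ E *
      ∫ y in closedBall x (ε n), ‖f y - f x‖) atTop (𝓝 0) := by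
  have hlim := (hx (fun _ => x) ε (tendsto_nhdsWithin_iff.2 ⟨hε0, .of_forall hε⟩) (.of_forall
    fun n => mem_closedBall_self (by linarith [hε n]))).const_mul (C * volume.real (ball (0 : E) 1))
  rw [mul_zero] at hlim
  refine hlim.congr fun n => ?_
  have hball : volume.real (ball (0 : E) 1) ≠ 0 :=
    (ENNReal.toReal_pos (measure_ball_pos volume 0 one_pos).ne' measure_ball_lt_top.ne).ne'
  rw [setAverage_eq, Measure.addHaar_real_closedBall _ _ (hε n).le, smul_eq_mul]
  field_simp

theorem IsApproximateIdentity.tendsto_mollify {C : ℝ} {ε : ℕ → ℝ} {ρ : ℕ → E → ℝ}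
    (hρ : IsApproximateIdentity C ε ρ) {f : E → ℝ} {x : E} (hf : LocallyIntegrable f)
    (hx : IsLebesguePoint f x) : Tendsto (fun n => mollify (ρ n) f x) atTop (𝓝 (f x)) :=
  tendsto_iff_norm_sub_tendsto_zero.2 <| squeeze_zero (fun _ => norm_nonneg _)
    (fun n => (hρ.isMollifier n).abs_mollify_sub_le hf (f x) x)
    (hx.tendsto_const_div_mul_integral (fun n => (hρ.isMollifier n).pos) hρ.tendsto_zero C)

end LebesguePoint

section WeightedMollification

variable {E : Type*} [NormedAddCommGroup E] [MeasureSpace E] [NormedSpace ℝ E]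
  [FiniteDimensional ℝ E] [BorelSpace E] [(volume : Measure E).IsAddHaarMeasure]

namespace IsMollifier

variable {C ε B : ℝ} {ρ f g w : E → ℝ}

theorem lintegral_mollify (h : IsMollifier C ε ρ) (hf : Integrable f) (hf0 : ∀ y, 0 ≤ f y) :
    ∫⁻ x, ENNReal.ofReal (mollify ρ f x) = ENNReal.ofReal (∫ y, f y) := by
  have hρ : Integrable ρ := h.smooth.continuous.integrable_of_hasCompactSupport h.hasCompactSupport
  have hint : Integrable (mollify ρ f) := by
    rw [mollify_eq_convolution]
    exact hf.integrable_convolution _ hρ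
  rw [← ofReal_integral_eq_lintegral_ofReal hint
      (.of_forall fun x => integral_nonneg fun y => mul_nonneg (hf0 y) (h.nonneg _)),
    mollify_eq_convolution, integral_convolution _ hf hρ, h.integral_eq_one,
    ContinuousLinearMap.mul_apply', mul_one]

theorem abs_mollify_le_mollify_abs_sub_add (h : IsMollifier C ε ρ) (hf : LocallyIntegrable f)
    (hg : LocallyIntegrable g) (hB : ∀ y, |g y| ≤ B) (x : E) :
    |mollify ρ f x| ≤ mollify ρ (fun y => |f y - g y|) x + B := by
  have hfg : LocallyIntegrable fun y => |f y - g y| := fun y => ((hf.sub hg) y).norm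
  have hfgB : LocallyIntegrable fun y => |f y - g y| + B := hfg.add (locallyIntegrable_const B)
  calc |mollify ρ f x| ≤ mollify ρ (fun y => |f y|) x := by
        refine abs_integral_le_integral_abs.trans_eq ?_
        simp only [mollify, abs_mul, abs_of_nonneg (h.nonneg _)]
    _ ≤ mollify ρ (fun y => |f y - g y| + B) x :=
        h.mollify_mono (f := fun y => |f y|) (fun y => (hf y).norm) hfgB
          (fun y => by linarith [abs_sub_abs_le_abs_sub (f y) (g y), hB y]) x
    _ = mollify ρ (fun y => |f y - g y|) x + B := by
        rw [h.mollify_add hfg (locallyIntegrable_const B), h.mollify_const]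

theorem setLIntegral_mul_abs_mollify_le (h : IsMollifier C ε ρ) (hf : Integrable f)
    (hg : Integrable g) (hB0 : 0 ≤ B) (hB : ∀ y, |g y| ≤ B) (hw : Measurable w)
    (hw01 : ∀ x, w x ∈ Set.Icc (0 : ℝ) 1) (K : Set E) :
    ∫⁻ x in K, ENNReal.ofReal (w x * |mollify ρ f x|) ≤
      ENNReal.ofReal (∫ y, |f y - g y|) + ENNReal.ofReal B * ∫⁻ x in K, ENNReal.ofReal (w x) := by
  have hfg : Integrable fun y => |f y - g y| := (hf.sub hg).abs
  have hpoint : ∀ x, ENNReal.ofReal (w x * |mollify ρ f x|) ≤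
      ENNReal.ofReal (mollify ρ (fun y => |f y - g y|) x) +
        ENNReal.ofReal B * ENNReal.ofReal (w x) := fun x => by
    have hm0 : 0 ≤ mollify ρ (fun y => |f y - g y|) x :=
      integral_nonneg fun y => mul_nonneg (abs_nonneg _) (h.nonneg _)
    rw [← ENNReal.ofReal_mul hB0, ← ENNReal.ofReal_add hm0 (mul_nonneg hB0 (hw01 x).1)]
    refine ENNReal.ofReal_le_ofReal ?_
    calc w x * |mollify ρ f x| ≤ w x * (mollify ρ (fun y => |f y - g y|) x + B) :=
          mul_le_mul_of_nonneg_left (h.abs_mollify_le_mollify_abs_sub_add hf.locallyIntegrable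
            hg.locallyIntegrable hB x) (hw01 x).1
      _ = w x * mollify ρ (fun y => |f y - g y|) x + B * w x := by ring
      _ ≤ _ := by gcongr; exact mul_le_of_le_one_left hm0 (hw01 x).2
  calc ∫⁻ x in K, ENNReal.ofReal (w x * |mollify ρ f x|)
      ≤ ∫⁻ x in K, (ENNReal.ofReal (mollify ρ (fun y => |f y - g y|) x) +
          ENNReal.ofReal B * ENNReal.ofReal (w x)) := lintegral_mono hpoint
    _ = (∫⁻ x in K, ENNReal.ofReal (mollify ρ (fun y => |f y - g y|) x)) +
          ENNReal.ofReal B * ∫⁻ x in K, ENNReal.ofReal (w x) := by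
        rw [lintegral_add_right _ (hw.ennreal_ofReal.const_mul _),
          lintegral_const_mul _ hw.ennreal_ofReal]
    _ ≤ _ := by
        gcongr
        exact (setLIntegral_le_lintegral _ _).trans_eq
          (h.lintegral_mollify hfg fun y => abs_nonneg _)

end IsMollifier

theorem IsApproximateIdentity.tendsto_setLIntegral_mul_abs_mollify {C : ℝ} {ε : ℕ → ℝ}
    {ρ w : ℕ → E → ℝ} {f : E → ℝ} {K : Set E} (hρ : IsApproximateIdentity C ε ρ)
    (hf : Integrable f) (hw : ∀ n, Measurable (w n)) (hw01 : ∀ n x, w n x ∈ Set.Icc (0 : ℝ) 1)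
    (hwK : Tendsto (fun n => ∫⁻ x in K, ENNReal.ofReal (w n x)) atTop (𝓝 0)) :
    Tendsto (fun n => ∫⁻ x in K, ENNReal.ofReal (w n x * |mollify (ρ n) f x|)) atTop (𝓝 0) := by
  rw [ENNReal.tendsto_nhds_zero]
  intro η hη
  obtain ⟨r, hr0, hrη⟩ := ENNReal.lt_iff_exists_nnreal_btwn.1 hη
  have hr : (0 : ℝ) < r / 2 := half_pos (by exact_mod_cast hr0)
  obtain ⟨g, hgs, hfg, hgc, hgi⟩ := hf.exists_hasCompactSupport_integral_sub_le hr
  obtain ⟨B, hB⟩ := hgc.bounded_above_of_compact_support hgs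
  have hsmall := ENNReal.Tendsto.const_mul hwK (.inr (ENNReal.ofReal_ne_top (r := B)))
  rw [mul_zero, ENNReal.tendsto_nhds_zero] at hsmall
  filter_upwards [hsmall _ (ENNReal.ofReal_pos.2 hr)] with n hn
  calc ∫⁻ x in K, ENNReal.ofReal (w n x * |mollify (ρ n) f x|)
      ≤ ENNReal.ofReal (∫ y, |f y - g y|)
          + ENNReal.ofReal B * ∫⁻ x in K, ENNReal.ofReal (w n x) :=
        (hρ.isMollifier n).setLIntegral_mul_abs_mollify_le hf hgi ((norm_nonneg _).trans (hB 0)) hB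
          (hw n) (hw01 n) K
    _ ≤ ENNReal.ofReal (r / 2) + ENNReal.ofReal (r / 2) :=
        add_le_add (ENNReal.ofReal_le_ofReal hfg) hn
    _ = r := by rw [← ENNReal.ofReal_add hr.le hr.le, add_halves, ENNReal.ofReal_coe_nnreal]
    _ ≤ η := hrη.le

end WeightedMollification

namespace IsUnitField

variable {Ω K : Set Plane} {u : Plane → Plane} {ξ x : Plane} {C : ℝ} {ε : ℕ → ℝ}
  {ρ : ℕ → Plane → ℝ} {G : Plane → Plane →L[ℝ] Plane}

theorem locallyIntegrable (hu : IsUnitField u) : LocallyIntegrable u :=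
  (locallyIntegrable_const (1 : ℝ)).mono hu.measurable.aestronglyMeasurable
    (.of_forall fun x => by simp [hu.norm_eq_one x])

theorem isLebesguePoint_component (hu : IsUnitField u) (hx : IsLebesguePoint u x) (ξ : Plane) :
    IsLebesguePoint (component ξ u) x :=
  hx.of_norm_sub_le (M := ‖ξ‖) hu.locallyIntegrable fun y => by
    rw [component, component, ← inner_sub_right]
    exact norm_inner_le_norm ξ (u y - u x)

theorem tendsto_mollify_component (hu : IsUnitField u) (hx : IsLebesguePoint u x)
    (hρ : IsApproximateIdentity C ε ρ) (ξ : Plane) :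
    Tendsto (fun n => mollify (ρ n) (component ξ u) x) atTop (𝓝 (component ξ u x)) :=
  hρ.tendsto_mollify (hu.locallyIntegrable_component ξ) (hu.isLebesguePoint_component hx ξ)

theorem tendsto_defect (hu : IsUnitField u) (hξ : ‖ξ‖ = 1) (hx : IsLebesguePoint u x)
    (hρ : IsApproximateIdentity C ε ρ) : Tendsto (fun n => defect (ρ n) ξ u x) atTop (𝓝 0) := by
  have hlim : 1 - component ξ u x ^ 2 - component (perp ξ) u x ^ 2 = 0 := by
    linarith [hu.component_sq_add_sq hξ x]
  rw [← hlim]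
  exact (((hu.tendsto_mollify_component hx hρ ξ).pow 2).const_sub 1).sub
    ((hu.tendsto_mollify_component hx hρ (perp ξ)).pow 2)

theorem continuous_defect (hu : IsUnitField u) {δ : ℝ} {φ : Plane → ℝ} (h : IsMollifier C δ φ)
    (ξ : Plane) : Continuous (defect φ ξ u) :=
  have hcont := fun ζ => (h.contDiff_mollify (hu.locallyIntegrable_component ζ)).continuous
  (continuous_const.sub ((hcont ξ).pow 2)).sub ((hcont (perp ξ)).pow 2)

theorem tendsto_setLIntegral_defect (hu : IsUnitField u) (hξ : ‖ξ‖ = 1)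
    (hρ : IsApproximateIdentity C ε ρ) (hK : IsCompact K) :
    Tendsto (fun n => ∫⁻ x in K, ENNReal.ofReal (defect (ρ n) ξ u x)) atTop (𝓝 0) := by
  rw [← lintegral_zero (μ := volume.restrict K)]
  refine tendsto_lintegral_of_dominated_convergence 1
    (fun n => (hu.continuous_defect (hρ.isMollifier n) ξ).measurable.ennreal_ofReal)
    (fun n => .of_forall fun x => ENNReal.ofReal_le_one.2 (defect_le_one (ρ n) ξ u x))
    (by simpa using hK.measure_lt_top.ne) ?_
  filter_upwards [ae_restrict_of_ae (ae_isLebesguePoint hu.locallyIntegrable)] with x hx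
  simpa only [ENNReal.ofReal_zero] using ENNReal.tendsto_ofReal (hu.tendsto_defect hξ hx hρ)

theorem setIntegral_fderiv_mul_component (hu : IsUnitField u) (hG : IsWeakDeriv Ω u G)
    (hGint : ∀ K, IsCompact K → K ⊆ Ω → IntegrableOn G K) {φ : Plane → ℝ}
    (hφ : IsTestFunction Ω φ) (ξ v : Plane) :
    ∫ x in Ω, fderiv ℝ φ x v * component ξ u x = -∫ x in Ω, φ x * ⟪ξ, G x v⟫ := by
  have hu_int : IntegrableOn (fun x => fderiv ℝ φ x v • u x) Ω :=
    (hu.locallyIntegrable.integrable_smul_left_of_hasCompactSupport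
      ((hφ.smooth.continuous_fderiv (by simp)).clm_apply continuous_const)
      (hφ.compact_support.fderiv_apply ℝ v)).integrableOn
  have hG_int : IntegrableOn (fun x => φ x • G x v) Ω := by
    have hGv : IntegrableOn (fun x => G x v) (tsupport φ) :=
      (hGint _ hφ.compact_support hφ.support_subset).apply_continuousLinearMap v
    have hφG : IntegrableOn (fun x => φ x • G x v) (tsupport φ) :=
      hGv.continuousOn_smul hφ.smooth.continuous.continuousOn hφ.compact_support
    have hsupp : Function.support (fun x => φ x • G x v) ⊆ tsupport φ :=
      (Function.support_smul_subset_left φ _).trans (subset_tsupport φ)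
    exact ((integrableOn_iff_integrable_of_support_subset hsupp).1 hφG).integrableOn
  have hinner := congrArg (fun e => ⟪ξ, e⟫) (hG φ hφ v)
  simp only [inner_neg_right] at hinner
  rw [← integral_inner hu_int, ← integral_inner hG_int] at hinner
  simpa only [real_inner_smul_right, component] using hinner

theorem fderiv_mollify_component_of_isWeakDeriv (hu : IsUnitField u) (hΩ : IsOpen Ω)
    (hG : IsWeakDeriv Ω u G) (hGint : ∀ K, IsCompact K → K ⊆ Ω → IntegrableOn G K) {δ : ℝ}
    {φ : Plane → ℝ} (h : IsMollifier C δ φ) (hK : MeasurableSet K) (hKΩ : K ⊆ Ω)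
    (hx : closedBall x δ ⊆ K) (ξ v : Plane) :
    fderiv ℝ (mollify φ (component ξ u)) x v =
      mollify φ (K.indicator fun y => ⟪ξ, G y v⟫) x := by
  have hxΩ : closedBall x δ ⊆ Ω := hx.trans hKΩ
  have htest := hu.setIntegral_fderiv_mul_component hG hGint (h.isTestFunction hxΩ) ξ v
  simp only [h.fderiv_comp_sub, neg_mul, integral_neg, neg_inj] at htest
  calc fderiv ℝ (mollify φ (component ξ u)) x v
      = ∫ y, fderiv ℝ φ (x - y) v * component ξ u y := by
        rw [h.fderiv_mollify (hu.locallyIntegrable_component ξ)]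
        simp only [mul_comm]
    _ = ∫ y in Ω, fderiv ℝ φ (x - y) v * component ξ u y :=
        (setIntegral_eq_integral_of_forall_compl_eq_zero fun y hy => by
          rw [h.fderiv_eq_zero_of_notMem fun hm => hy (hxΩ hm), zero_apply, zero_mul]).symm
    _ = ∫ y in Ω, φ (x - y) * ⟪ξ, G y v⟫ := htest
    _ = ∫ y in K, φ (x - y) * ⟪ξ, G y v⟫ :=
        setIntegral_eq_of_subset_of_forall_sdiff_eq_zero hΩ.measurableSet hKΩ fun y hy => by
          rw [h.eq_zero_of_notMem fun hm => hy.2 (hx hm), zero_mul]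
    _ = mollify φ (K.indicator fun y => ⟪ξ, G y v⟫) x := by
        rw [mollify, ← integral_indicator hK]
        simp only [Set.indicator_mul_right, mul_comm]

theorem commutatorVanishes_of_isWeakDeriv (hu : IsUnitField u) (hΩ : IsOpen Ω)
    (hG : IsWeakDeriv Ω u G) (hGint : ∀ K, IsCompact K → K ⊆ Ω → IntegrableOn G K) :
    CommutatorVanishes Ω u := by
  intro C ε ρ hρ ξ hξ v K hKΩ hK
  obtain ⟨δ, hδ, hδΩ⟩ := hK.exists_cthickening_subset_open hΩ hKΩ
  have hKδ : IsCompact (cthickening δ K) := hK.cthickening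
  have hf : Integrable ((cthickening δ K).indicator fun y => ⟪ξ, G y v⟫) :=
    (integrable_indicator_iff hKδ.measurableSet).2
      (((hGint _ hKδ hδΩ).apply_continuousLinearMap v).const_inner ξ)
  refine (hρ.tendsto_setLIntegral_mul_abs_mollify hf
    (fun n => (hu.continuous_defect (hρ.isMollifier n) ξ).measurable)
    (fun n x => ⟨hu.defect_nonneg (hρ.isMollifier n) hξ x, defect_le_one _ _ _ x⟩)
    (hu.tendsto_setLIntegral_defect hξ hρ hK)).congr' ?_
  filter_upwards [hρ.tendsto_zero.eventually (gt_mem_nhds hδ)] with n hn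
  refine setLIntegral_congr_fun hK.measurableSet fun x hx => ?_
  have hball : closedBall x (ε n) ⊆ cthickening δ K :=
    (closedBall_subset_closedBall hn.le).trans (closedBall_subset_cthickening hx δ)
  simp only [hu.fderiv_mollify_component_of_isWeakDeriv hΩ hG hGint (hρ.isMollifier n)
    hKδ.measurableSet hδΩ hball]

end IsUnitField

section Entropy

variable {δ s t : ℝ}

/-- The regularization of `|s|⁻¹` at scale `δ`. -/
noncomputable def invMod (δ s : ℝ) : ℝ := (√(s ^ 2 + δ ^ 2))⁻¹

/-- The first component of a smooth entropy `(Φ, Ψ)` of the eikonal equation. As `δ → 0` it tends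
to `sign s`. -/
noncomputable def entropyFst (δ s : ℝ) : ℝ := (1 + δ ^ 2) * (s * invMod δ s)

/-- The second component of the smooth entropy with first component `entropyFst`. It is extended off
the unit circle so that `∂Φ/∂s - ∂Ψ/∂t` and `∂Ψ/∂s` are multiples of `1 - s² - t²`; on the circle it
is `O(δ)`. -/
noncomputable def entropySnd (δ s t : ℝ) : ℝ :=
  δ ^ 2 * (t * invMod δ s) - δ ^ 2 / 2 * (invMod δ s ^ 3 * (t * (1 - s ^ 2 - t ^ 2)))

theorem invMod_nonneg (δ s : ℝ) : 0 ≤ invMod δ s := inv_nonneg.2 (Real.sqrt_nonneg _)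

theorem invMod_sq_mul (hδ : 0 < δ) (s : ℝ) : invMod δ s ^ 2 * (s ^ 2 + δ ^ 2) = 1 := by
  rw [invMod, inv_pow, Real.sq_sqrt (by positivity)]
  exact inv_mul_cancel₀ (by positivity)

theorem invMod_le_inv (hδ : 0 < δ) (s : ℝ) : invMod δ s ≤ δ⁻¹ :=
  inv_anti₀ hδ (Real.le_sqrt_of_sq_le (le_add_of_nonneg_left (sq_nonneg s)))

theorem abs_mul_invMod_le_one (hδ : 0 < δ) (s : ℝ) : |s * invMod δ s| ≤ 1 := by
  rw [← sq_le_one_iff_abs_le_one, mul_pow]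
  nlinarith [invMod_sq_mul hδ s, mul_nonneg (sq_nonneg (invMod δ s)) (sq_nonneg δ)]

theorem contDiff_invMod (hδ : 0 < δ) : ContDiff ℝ ∞ (invMod δ) :=
  have hpos : ∀ s : ℝ, 0 < s ^ 2 + δ ^ 2 := fun s => by positivity
  (((contDiff_id.pow 2).add contDiff_const).sqrt fun s => (hpos s).ne').inv
    fun s => (Real.sqrt_pos.2 (hpos s)).ne'

theorem contDiff_entropyFst (hδ : 0 < δ) : ContDiff ℝ ∞ (entropyFst δ) :=
  contDiff_const.mul (contDiff_id.mul (contDiff_invMod hδ))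

theorem contDiff_entropySnd (hδ : 0 < δ) : ContDiff ℝ ∞ fun z : ℝ × ℝ => entropySnd δ z.1 z.2 := by
  have hR : ContDiff ℝ ∞ fun z : ℝ × ℝ => invMod δ z.1 := (contDiff_invMod hδ).comp contDiff_fst
  exact (contDiff_const.mul (contDiff_snd.mul hR)).sub (contDiff_const.mul ((hR.pow 3).mul
    (contDiff_snd.mul ((contDiff_const.sub (contDiff_fst.pow 2)).sub (contDiff_snd.pow 2)))))

theorem hasDerivAt_invMod (hδ : 0 < δ) (s : ℝ) :
    HasDerivAt (invMod δ) (-s * invMod δ s ^ 3) s := by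
  have hpos : 0 < s ^ 2 + δ ^ 2 := by positivity
  have hsqrt := (Real.sqrt_pos.2 hpos).ne'
  have hsq : HasDerivAt (fun s => s ^ 2 + δ ^ 2) (2 * s) s := by
    simpa using (hasDerivAt_pow 2 s).add_const (δ ^ 2)
  refine ((hsq.sqrt hpos.ne').inv hsqrt).congr_deriv ?_
  unfold invMod
  field_simp

theorem hasDerivAt_entropyFst (hδ : 0 < δ) (s : ℝ) :
    HasDerivAt (entropyFst δ) ((1 + δ ^ 2) * δ ^ 2 * invMod δ s ^ 3) s := by
  refine (((hasDerivAt_id s).mul (hasDerivAt_invMod hδ s)).const_mul (1 + δ ^ 2)).congr_deriv ?_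
  simp only [id]
  linear_combination (-(1 + δ ^ 2) * invMod δ s) * invMod_sq_mul hδ s

theorem hasDerivAt_entropySnd (hδ : 0 < δ) {a b : ℝ → ℝ} {a' b' : ℝ} (ha : HasDerivAt a a' s)
    (hb : HasDerivAt b b' s) : HasDerivAt (fun s => entropySnd δ (a s) (b s))
      (3 / 2 * δ ^ 2 * invMod δ (a s) ^ 5 * (a s * b s) * (1 - a s ^ 2 - b s ^ 2) * a' +
        (δ ^ 2 * invMod δ (a s) -
          δ ^ 2 / 2 * invMod δ (a s) ^ 3 * (1 - a s ^ 2 - 3 * b s ^ 2)) * b') s := by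
  have hR : HasDerivAt (fun s => invMod δ (a s)) (-a s * invMod δ (a s) ^ 3 * a') s :=
    (hasDerivAt_invMod hδ (a s)).comp s ha
  refine (((hb.mul hR).const_mul (δ ^ 2)).sub (((hR.pow 3).mul
    (hb.mul (((ha.pow 2).const_sub 1).sub (hb.pow 2)))).const_mul (δ ^ 2 / 2))).congr_deriv ?_
  simp only [Nat.cast_ofNat, Nat.reduceSub, pow_one, Pi.pow_apply, Pi.mul_apply, Pi.sub_apply]
  ring

theorem abs_entropyFst_le (hδ : 0 < δ) (s : ℝ) : |entropyFst δ s| ≤ 1 + δ ^ 2 := by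
  rw [entropyFst, abs_mul, abs_of_nonneg (by positivity)]
  exact mul_le_of_le_one_right (by positivity) (abs_mul_invMod_le_one hδ s)

theorem abs_entropySnd_le (hδ : 0 < δ) (hst : s ^ 2 + t ^ 2 ≤ 1) :
    |entropySnd δ s t| ≤ δ ^ 2 * δ⁻¹ + δ ^ 2 / 2 * δ⁻¹ ^ 3 := by
  have hR0 := invMod_nonneg δ s
  have hR := invMod_le_inv hδ s
  have ht : |t| ≤ 1 := abs_le_one_iff_mul_self_le_one.2 (by nlinarith [sq_nonneg s])
  have hw : |1 - s ^ 2 - t ^ 2| ≤ 1 := by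
    rw [abs_le]
    constructor <;> nlinarith [sq_nonneg s, sq_nonneg t]
  calc |entropySnd δ s t|
      ≤ |δ ^ 2 * (t * invMod δ s)| +
          |δ ^ 2 / 2 * (invMod δ s ^ 3 * (t * (1 - s ^ 2 - t ^ 2)))| := abs_sub _ _
    _ = δ ^ 2 * (|t| * invMod δ s) +
          δ ^ 2 / 2 * (invMod δ s ^ 3 * (|t| * |1 - s ^ 2 - t ^ 2|)) := by
        simp only [abs_mul, abs_pow, abs_div, abs_of_pos hδ, abs_of_nonneg hR0, abs_two]
    _ ≤ δ ^ 2 * (1 * δ⁻¹) + δ ^ 2 / 2 * (δ⁻¹ ^ 3 * (1 * 1)) := by gcongr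
    _ = _ := by ring

theorem abs_entropySnd_le_of_sq_add_sq_eq_one (hδ : 0 < δ) (hst : s ^ 2 + t ^ 2 = 1) :
    |entropySnd δ s t| ≤ δ := by
  have ht : |t| ≤ 1 := abs_le_one_iff_mul_self_le_one.2 (by nlinarith [sq_nonneg s])
  have hw : 1 - s ^ 2 - t ^ 2 = 0 := by linarith
  calc |entropySnd δ s t| = δ ^ 2 * (|t| * invMod δ s) := by
        simp only [entropySnd, hw, mul_zero, sub_zero, abs_mul, abs_pow, abs_of_pos hδ,
          abs_of_nonneg (invMod_nonneg δ s)]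
    _ ≤ δ ^ 2 * (1 * δ⁻¹) := by
        gcongr
        exacts [invMod_nonneg δ s, invMod_le_inv hδ s]
    _ = δ := by field_simp

theorem tendsto_entropyFst (s : ℝ) :
    Tendsto (fun δ => entropyFst δ s) (𝓝[>] 0) (𝓝 (Real.sign s)) := by
  have hcont : s ≠ 0 → ContinuousAt (fun δ => entropyFst δ s) 0 := fun hs => by
    have hsqrt : √(s ^ 2 + 0 ^ 2) ≠ 0 := by positivity
    unfold entropyFst invMod
    fun_prop (disch := exact hsqrt)
  have hval : entropyFst 0 s = Real.sign s := by
    rcases lt_trichotomy s 0 with hs | rfl | hs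
    · simp [entropyFst, invMod, Real.sqrt_sq_eq_abs, abs_of_neg hs, Real.sign_of_neg hs, hs.ne]
    · simp [entropyFst]
    · simp [entropyFst, invMod, Real.sqrt_sq_eq_abs, abs_of_pos hs, Real.sign_of_pos hs, hs.ne']
  rcases eq_or_ne s 0 with rfl | hs
  · simp [entropyFst]
  · rw [← hval]
    exact (hcont hs).tendsto.mono_left nhdsWithin_le_nhds

end Entropy

section EntropyProduction

variable {δ : ℝ} {ξ x : Plane} {a b : Plane → ℝ}

/-- The divergence of `entropyFst δ a • ξ + entropySnd δ a b • ξ^⊥`, where `a` and `b` stand for the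
coordinates of a field in the frame `(ξ, ξ^⊥)`. -/
noncomputable def entropyProduction (δ : ℝ) (ξ : Plane) (a b : Plane → ℝ) (x : Plane) : ℝ :=
  fderiv ℝ (fun x => entropyFst δ (a x)) x ξ +
    fderiv ℝ (fun x => entropySnd δ (a x) (b x)) x (perp ξ)

/-- Minus the distributional entropy production tested against `ζ`; it makes sense for fields that
are merely bounded. -/
noncomputable def entropyPairing (δ : ℝ) (ξ : Plane) (ζ a b : Plane → ℝ) : ℝ :=
  ∫ x, (fderiv ℝ ζ x ξ * entropyFst δ (a x) + fderiv ℝ ζ x (perp ξ) * entropySnd δ (a x) (b x))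

theorem entropyProduction_eq (hδ : 0 < δ) (ha : DifferentiableAt ℝ a x)
    (hb : DifferentiableAt ℝ b x) (hdiv : fderiv ℝ a x ξ + fderiv ℝ b x (perp ξ) = 0) :
    entropyProduction δ ξ a b x = (1 - a x ^ 2 - b x ^ 2) *
      (3 / 2 * δ ^ 2 * invMod δ (a x) ^ 3 * fderiv ℝ a x ξ +
        3 / 2 * δ ^ 2 * invMod δ (a x) ^ 5 * (a x * b x) * fderiv ℝ a x (perp ξ)) := by
  have hline : ∀ {f : Plane → ℝ} (v : Plane), DifferentiableAt ℝ f x →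
      HasDerivAt (fun r : ℝ => f (x + r • v)) (fderiv ℝ f x v) 0 := fun v hf =>
    hf.hasFDerivAt.hasLineDerivAt v
  have hfst : fderiv ℝ (fun x => entropyFst δ (a x)) x ξ =
      (1 + δ ^ 2) * δ ^ 2 * invMod δ (a x) ^ 3 * fderiv ℝ a x ξ := by
    have h : HasFDerivAt (fun x => entropyFst δ (a x)) _ x :=
      (hasDerivAt_entropyFst hδ (a x)).comp_hasFDerivAt x ha.hasFDerivAt
    rw [h.fderiv]
    rfl
  have hsnd_diff : DifferentiableAt ℝ (fun x => entropySnd δ (a x) (b x)) x :=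
    ((contDiff_entropySnd hδ).differentiable (by simp) (a x, b x)).fun_comp' x (ha.prodMk hb)
  have hsnd := (hline (perp ξ) hsnd_diff).unique
    (hasDerivAt_entropySnd hδ (hline (perp ξ) ha) (hline (perp ξ) hb))
  simp only [zero_smul, add_zero] at hsnd
  rw [entropyProduction, hfst, hsnd, eq_neg_of_add_eq_zero_right hdiv]
  linear_combination (δ ^ 2 * invMod δ (a x) * fderiv ℝ a x ξ) * invMod_sq_mul hδ (a x)

theorem abs_entropyProduction_le (hδ : 0 < δ) (ha : DifferentiableAt ℝ a x)
    (hb : DifferentiableAt ℝ b x) (hdiv : fderiv ℝ a x ξ + fderiv ℝ b x (perp ξ) = 0)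
    (hab : a x ^ 2 + b x ^ 2 ≤ 1) :
    |entropyProduction δ ξ a b x| ≤ 3 / 2 * δ ^ 2 * (δ⁻¹ ^ 3 + δ⁻¹ ^ 5) *
      ((1 - a x ^ 2 - b x ^ 2) * |fderiv ℝ a x ξ| +
        (1 - a x ^ 2 - b x ^ 2) * |fderiv ℝ a x (perp ξ)|) := by
  have hR0 := invMod_nonneg δ (a x)
  have hR := invMod_le_inv hδ (a x)
  have hw : 0 ≤ 1 - a x ^ 2 - b x ^ 2 := by linarith
  have hab' : |a x * b x| ≤ 1 := by
    rw [abs_le]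
    constructor <;> nlinarith [sq_nonneg (a x + b x), sq_nonneg (a x - b x)]
  rw [entropyProduction_eq hδ ha hb hdiv, abs_mul, abs_of_nonneg hw]
  generalize fderiv ℝ a x ξ = p, fderiv ℝ a x (perp ξ) = q, invMod δ (a x) = R at hR0 hR ⊢
  calc (1 - a x ^ 2 - b x ^ 2) *
        |3 / 2 * δ ^ 2 * R ^ 3 * p + 3 / 2 * δ ^ 2 * R ^ 5 * (a x * b x) * q|
      ≤ (1 - a x ^ 2 - b x ^ 2) *
          (3 / 2 * δ ^ 2 * R ^ 3 * |p| + 3 / 2 * δ ^ 2 * R ^ 5 * |a x * b x| * |q|) := by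
        refine mul_le_mul_of_nonneg_left ((abs_add_le _ _).trans_eq ?_) hw
        rw [abs_mul _ p, abs_mul _ q, abs_mul _ (a x * b x), abs_of_nonneg (by positivity),
          abs_of_nonneg (by positivity : 0 ≤ 3 / 2 * δ ^ 2 * R ^ 5)]
    _ ≤ (1 - a x ^ 2 - b x ^ 2) * (3 / 2 * δ ^ 2 * (δ⁻¹ ^ 3 + δ⁻¹ ^ 5) * |p| +
          3 / 2 * δ ^ 2 * (δ⁻¹ ^ 3 + δ⁻¹ ^ 5) * 1 * |q|) := by
        gcongr
        · exact (pow_le_pow_left₀ hR0 hR 3).trans (le_add_of_nonneg_right (by positivity))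
        · exact (pow_le_pow_left₀ hR0 hR 5).trans (le_add_of_nonneg_left (by positivity))
    _ = _ := by ring

end EntropyProduction

namespace IsTestFunction

variable {Ω : Set Plane} {ζ f : Plane → ℝ}

theorem continuous_fderiv_apply (hζ : IsTestFunction Ω ζ) (v : Plane) :
    Continuous fun x => fderiv ℝ ζ x v :=
  (hζ.smooth.continuous_fderiv (by simp)).clm_apply continuous_const

theorem integrable_fderiv_apply (hζ : IsTestFunction Ω ζ) (v : Plane) :
    Integrable fun x => fderiv ℝ ζ x v :=
  (hζ.continuous_fderiv_apply v).integrable_of_hasCompactSupport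
    (hζ.compact_support.fderiv_apply ℝ v)

theorem integrable_fderiv_mul (hζ : IsTestFunction Ω ζ) (hf : Continuous f) (v : Plane) :
    Integrable fun x => fderiv ℝ ζ x v * f x :=
  ((hζ.continuous_fderiv_apply v).mul hf).integrable_of_hasCompactSupport
    (hζ.compact_support.fderiv_apply ℝ v).mul_right

theorem integrable_mul (hζ : IsTestFunction Ω ζ) (hf : Continuous f) :
    Integrable fun x => ζ x * f x :=
  (hζ.smooth.continuous.mul hf).integrable_of_hasCompactSupport hζ.compact_support.mul_right

theorem integral_fderiv_mul (hζ : IsTestFunction Ω ζ) (hf : ContDiff ℝ 1 f) (v : Plane) :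
    ∫ x, fderiv ℝ ζ x v * f x = -∫ x, ζ x * fderiv ℝ f x v := by
  rw [integral_mul_fderiv_eq_neg_fderiv_mul_of_integrable
    (hζ.integrable_fderiv_mul hf.continuous v)
    (hζ.integrable_mul ((hf.continuous_fderiv one_ne_zero).clm_apply continuous_const))
    (hζ.integrable_mul hf.continuous) (fun x _ => hζ.smooth.differentiable (by simp) x)
    (fun x _ => hf.differentiable one_ne_zero x), neg_neg]

theorem entropyPairing_eq (hζ : IsTestFunction Ω ζ) {δ : ℝ} (hδ : 0 < δ) (ξ : Plane)
    {a b : Plane → ℝ} (ha : ContDiff ℝ ∞ a) (hb : ContDiff ℝ ∞ b) :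
    entropyPairing δ ξ ζ a b = -∫ x, ζ x * entropyProduction δ ξ a b x := by
  have hfst : ContDiff ℝ 1 fun x => entropyFst δ (a x) :=
    ((contDiff_entropyFst hδ).comp ha).of_le (by simp)
  have hsnd : ContDiff ℝ 1 fun x => entropySnd δ (a x) (b x) :=
    ((contDiff_entropySnd hδ).comp (ha.prodMk hb)).of_le (by simp)
  have hfderiv : ∀ {f : Plane → ℝ} (v : Plane), ContDiff ℝ 1 f →
      Integrable fun x => ζ x * fderiv ℝ f x v := fun v hf =>
    hζ.integrable_mul ((hf.continuous_fderiv one_ne_zero).clm_apply continuous_const)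
  simp only [entropyPairing, entropyProduction, mul_add]
  rw [integral_add (hζ.integrable_fderiv_mul hfst.continuous ξ)
      (hζ.integrable_fderiv_mul hsnd.continuous (perp ξ)),
    integral_add (hfderiv ξ hfst) (hfderiv (perp ξ) hsnd), hζ.integral_fderiv_mul hfst,
    hζ.integral_fderiv_mul hsnd, neg_add]

end IsTestFunction

section KineticEquation

variable {Ω : Set Plane} {u : Plane → Plane} {ξ x : Plane} {ζ ρ : Plane → ℝ} {C δ ε : ℝ}

/-- The kinetic formulation of the eikonal equation in `Ω`: `ξ · ∇ sign (ξ · u) = 0` in the sense of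
distributions, for every direction `ξ`. -/
def KineticEquation (Ω : Set Plane) (u : Plane → Plane) : Prop :=
  ∀ (ξ : Plane) ⦃ζ : Plane → ℝ⦄, IsTestFunction Ω ζ →
    ∫ x, fderiv ℝ ζ x ξ * Real.sign (component ξ u x) = 0

theorem inner_smul_add_inner_perp_smul (hξ : ‖ξ‖ = 1) (e : Plane) :
    ⟪ξ, e⟫ • ξ + ⟪perp ξ, e⟫ • perp ξ = e := by
  have hsq : ξ 0 ^ 2 + ξ 1 ^ 2 = 1 := by rw [← Plane.norm_sq_eq, hξ, one_pow]
  refine Plane.ext ?_ ?_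
  · simp only [Plane.inner_eq, PiLp.add_apply, PiLp.smul_apply, smul_eq_mul, perp_apply_zero,
      perp_apply_one]
    linear_combination e 0 * hsq
  · simp only [Plane.inner_eq, PiLp.add_apply, PiLp.smul_apply, smul_eq_mul, perp_apply_zero,
      perp_apply_one]
    linear_combination e 1 * hsq

theorem exists_pos_forall_closedBall_subset {E : Type*} [PseudoMetricSpace E] {K Ω : Set E}
    (hΩ : IsOpen Ω) (hK : IsCompact K) (hKΩ : K ⊆ Ω) :
    ∃ τ > 0, ∀ ε < τ, ∀ x ∈ K, closedBall x ε ⊆ Ω := by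
  obtain ⟨τ, hτ, hsub⟩ := hK.exists_cthickening_subset_open hΩ hKΩ
  exact ⟨τ, hτ, fun ε hε x hx => ((closedBall_subset_closedBall hε.le).trans
    (closedBall_subset_cthickening hx τ)).trans hsub⟩

theorem sign_mul_of_pos {r : ℝ} (hr : 0 < r) (s : ℝ) : Real.sign (r * s) = Real.sign s := by
  simp only [Real.sign, ← smul_eq_mul, smul_pos_iff_of_pos_left hr, smul_neg_iff_of_pos_left hr]

namespace IsUnitField

theorem div_mollify_eq_zero (hu : IsUnitField u) (hdiv : IsDivFree Ω u)
    (h : IsMollifier C ε ρ) (hξ : ‖ξ‖ = 1) (hx : closedBall x ε ⊆ Ω) :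
    fderiv ℝ (mollify ρ (component ξ u)) x ξ +
      fderiv ℝ (mollify ρ (component (perp ξ) u)) x (perp ξ) = 0 := by
  have hint := hu.locallyIntegrable_component
  have hframe : ∀ y, component ξ u y * fderiv ℝ ρ (x - y) ξ +
      component (perp ξ) u y * fderiv ℝ ρ (x - y) (perp ξ) = fderiv ℝ ρ (x - y) (u y) := fun y => by
    conv_rhs => rw [← inner_smul_add_inner_perp_smul hξ (u y)]
    simp only [component, map_add, map_smul, smul_eq_mul]
  have htest := hdiv _ (h.isTestFunction hx)
  simp only [h.fderiv_comp_sub, integral_neg, neg_eq_zero] at htest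
  rw [setIntegral_eq_integral_of_forall_compl_eq_zero fun y hy => by
    rw [h.fderiv_eq_zero_of_notMem fun hmem => hy (hx hmem), zero_apply]] at htest
  rw [h.fderiv_mollify (hint ξ), h.fderiv_mollify (hint (perp ξ)),
    ← integral_add (h.integrable_mul_fderiv_comp_sub (hint ξ) x ξ)
      (h.integrable_mul_fderiv_comp_sub (hint (perp ξ)) x (perp ξ))]
  simp only [hframe, htest]

theorem enorm_entropyPairing_mollify_le (hu : IsUnitField u) (hdiv : IsDivFree Ω u)
    (h : IsMollifier C ε ρ) (hξ : ‖ξ‖ = 1) (hδ : 0 < δ) (hζ : IsTestFunction Ω ζ) {B : ℝ}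
    (hB : ∀ x, |ζ x| ≤ B) (hsub : ∀ x ∈ tsupport ζ, closedBall x ε ⊆ Ω) :
    ‖entropyPairing δ ξ ζ (mollify ρ (component ξ u)) (mollify ρ (component (perp ξ) u))‖ₑ ≤
      ENNReal.ofReal (B * (3 / 2 * δ ^ 2 * (δ⁻¹ ^ 3 + δ⁻¹ ^ 5))) *
        ((∫⁻ x in tsupport ζ, ENNReal.ofReal (defect ρ ξ u x *
            |fderiv ℝ (mollify ρ (component ξ u)) x ξ|)) +
          ∫⁻ x in tsupport ζ, ENNReal.ofReal (defect ρ ξ u x *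
            |fderiv ℝ (mollify ρ (component ξ u)) x (perp ξ)|)) := by
  have hint := hu.locallyIntegrable_component
  have ha := h.contDiff_mollify (hint ξ)
  have hb := h.contDiff_mollify (hint (perp ξ))
  have hB0 : 0 ≤ B := (abs_nonneg _).trans (hB 0)
  have hpt : ∀ x ∈ tsupport ζ, ‖ζ x * entropyProduction δ ξ (mollify ρ (component ξ u))
      (mollify ρ (component (perp ξ) u)) x‖ₑ ≤
      ENNReal.ofReal (B * (3 / 2 * δ ^ 2 * (δ⁻¹ ^ 3 + δ⁻¹ ^ 5))) *
        (ENNReal.ofReal (defect ρ ξ u x * |fderiv ℝ (mollify ρ (component ξ u)) x ξ|) +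
          ENNReal.ofReal (defect ρ ξ u x *
            |fderiv ℝ (mollify ρ (component ξ u)) x (perp ξ)|)) := fun x hx => by
    have hdefect := hu.defect_nonneg h hξ x
    rw [← ENNReal.ofReal_add (by positivity) (by positivity),
      ← ENNReal.ofReal_mul (by positivity), Real.enorm_eq_ofReal_abs, abs_mul, mul_assoc B]
    exact ENNReal.ofReal_le_ofReal <| mul_le_mul (hB x)
      (abs_entropyProduction_le hδ (ha.differentiable (by simp) x)
        (hb.differentiable (by simp) x) (hu.div_mollify_eq_zero hdiv h hξ (hsub x hx))
        (h.mollify_sq_add_mollify_sq_le_one (hint ξ) (hint (perp ξ))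
          (hu.component_sq_add_sq hξ) x)) (abs_nonneg _) hB0
  have hmeas : Measurable fun x =>
      ENNReal.ofReal (defect ρ ξ u x * |fderiv ℝ (mollify ρ (component ξ u)) x ξ|) :=
    ENNReal.measurable_ofReal.comp ((hu.continuous_defect h ξ).mul
      ((ha.continuous_fderiv (by simp)).clm_apply continuous_const).abs).measurable
  rw [hζ.entropyPairing_eq hδ ξ ha hb, enorm_neg,
    ← setIntegral_eq_integral_of_forall_compl_eq_zero (s := tsupport ζ) fun x hx => by
      rw [image_eq_zero_of_notMem_tsupport hx, zero_mul]]
  refine (enorm_integral_le_lintegral_enorm _).trans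
    ((setLIntegral_mono' (isClosed_tsupport ζ).measurableSet hpt).trans_eq ?_)
  rw [lintegral_const_mul' _ _ ENNReal.ofReal_ne_top, lintegral_add_left hmeas]

variable {εs : ℕ → ℝ} {ρs : ℕ → Plane → ℝ}

theorem tendsto_entropyPairing_mollify (hu : IsUnitField u) (hΩ : IsOpen Ω)
    (hdiv : IsDivFree Ω u) (hcomm : CommutatorVanishes Ω u) (hρ : IsApproximateIdentity C εs ρs)
    (hξ : ‖ξ‖ = 1) (hδ : 0 < δ) (hζ : IsTestFunction Ω ζ) :
    Tendsto (fun n => entropyPairing δ ξ ζ (mollify (ρs n) (component ξ u))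
      (mollify (ρs n) (component (perp ξ) u))) atTop (𝓝 0) := by
  have hK : IsCompact (tsupport ζ) := hζ.compact_support
  obtain ⟨τ, hτ, hball⟩ := exists_pos_forall_closedBall_subset hΩ hK hζ.support_subset
  obtain ⟨B, hB⟩ := hζ.smooth.continuous.bounded_above_of_compact_support hζ.compact_support
  have hlim := fun v => hcomm hρ ξ hξ v _ hζ.support_subset hK
  have hbound := ENNReal.Tendsto.const_mul
    (a := ENNReal.ofReal (B * (3 / 2 * δ ^ 2 * (δ⁻¹ ^ 3 + δ⁻¹ ^ 5))))
    ((hlim ξ).add (hlim (perp ξ))) (Or.inr ENNReal.ofReal_ne_top)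
  rw [add_zero, mul_zero] at hbound
  refine tendsto_zero_iff_enorm_tendsto_zero.2
    (tendsto_of_tendsto_of_tendsto_of_le_of_le' tendsto_const_nhds hbound
      (.of_forall fun _ => zero_le) ?_)
  filter_upwards [hρ.tendsto_zero.eventually (gt_mem_nhds hτ)] with n hn
  exact hu.enorm_entropyPairing_mollify_le hdiv (hρ.isMollifier n) hξ hδ hζ hB (hball _ hn)

theorem tendsto_entropyPairing (hu : IsUnitField u) (hρ : IsApproximateIdentity C εs ρs)
    (hξ : ‖ξ‖ = 1) (hδ : 0 < δ) (hζ : IsTestFunction Ω ζ) :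
    Tendsto (fun n => entropyPairing δ ξ ζ (mollify (ρs n) (component ξ u))
      (mollify (ρs n) (component (perp ξ) u))) atTop
      (𝓝 (entropyPairing δ ξ ζ (component ξ u) (component (perp ξ) u))) := by
  have hint := hu.locallyIntegrable_component
  have hcont : ∀ n η, Continuous (mollify (ρs n) (component η u)) := fun n η =>
    ((hρ.isMollifier n).contDiff_mollify (hint η)).continuous
  have hfst := (contDiff_entropyFst hδ).continuous
  have hsnd := (contDiff_entropySnd hδ).continuous
  refine tendsto_integral_of_dominated_convergence
    (fun x => ‖fderiv ℝ ζ x ξ‖ * (1 + δ ^ 2) +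
      ‖fderiv ℝ ζ x (perp ξ)‖ * (δ ^ 2 * δ⁻¹ + δ ^ 2 / 2 * δ⁻¹ ^ 3))
    (fun n => Continuous.aestronglyMeasurable ?_)
    (((hζ.integrable_fderiv_apply ξ).norm.mul_const _).add
      ((hζ.integrable_fderiv_apply (perp ξ)).norm.mul_const _))
    (fun n => .of_forall fun x => (norm_add_le _ _).trans ?_) ?_
  · exact ((hζ.continuous_fderiv_apply ξ).mul (hfst.comp (hcont n ξ))).add
      ((hζ.continuous_fderiv_apply _).mul (hsnd.comp ((hcont n ξ).prodMk (hcont n (perp ξ)))))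
  · rw [norm_mul, norm_mul]
    gcongr
    · exact abs_entropyFst_le hδ _
    · exact abs_entropySnd_le hδ ((hρ.isMollifier n).mollify_sq_add_mollify_sq_le_one (hint ξ)
        (hint (perp ξ)) (hu.component_sq_add_sq hξ) x)
  · filter_upwards [ae_isLebesguePoint hu.locallyIntegrable] with x hx
    have ha := hu.tendsto_mollify_component hx hρ ξ
    have hb := hu.tendsto_mollify_component hx hρ (perp ξ)
    exact (((hfst.tendsto _).comp ha).const_mul _).add
      (((hsnd.tendsto _).comp (ha.prodMk_nhds hb)).const_mul _)

theorem entropyPairing_component_eq_zero (hu : IsUnitField u) (hΩ : IsOpen Ω)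
    (hdiv : IsDivFree Ω u) (hcomm : CommutatorVanishes Ω u) (hξ : ‖ξ‖ = 1) (hδ : 0 < δ)
    (hζ : IsTestFunction Ω ζ) :
    entropyPairing δ ξ ζ (component ξ u) (component (perp ξ) u) = 0 := by
  obtain ⟨C, ε, ρ, hρ⟩ := exists_isApproximateIdentity Plane
  exact tendsto_nhds_unique (hu.tendsto_entropyPairing hρ hξ hδ hζ)
    (hu.tendsto_entropyPairing_mollify hΩ hdiv hcomm hρ hξ hδ hζ)

theorem tendsto_entropyPairing_component (hu : IsUnitField u) (hξ : ‖ξ‖ = 1)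
    (hζ : IsTestFunction Ω ζ) :
    Tendsto (fun δ => entropyPairing δ ξ ζ (component ξ u) (component (perp ξ) u)) (𝓝[>] 0)
      (𝓝 (∫ x, fderiv ℝ ζ x ξ * Real.sign (component ξ u x))) := by
  have hsmall : ∀ᶠ δ : ℝ in 𝓝[>] 0, 0 < δ ∧ δ ≤ 1 :=
    Filter.mem_of_superset (Ioc_mem_nhdsGT one_pos) fun δ hδ => hδ
  have hmeas := hu.measurable_component
  have hsnd : ∀ δ > 0, ∀ x, |entropySnd δ (component ξ u x) (component (perp ξ) u x)| ≤ δ :=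
    fun δ hδ x => abs_entropySnd_le_of_sq_add_sq_eq_one hδ (hu.component_sq_add_sq hξ x)
  refine tendsto_integral_filter_of_dominated_convergence
    (fun x => ‖fderiv ℝ ζ x ξ‖ * 2 + ‖fderiv ℝ ζ x (perp ξ)‖ * 1) ?_ ?_
    (((hζ.integrable_fderiv_apply ξ).norm.mul_const _).add
      ((hζ.integrable_fderiv_apply (perp ξ)).norm.mul_const _)) (.of_forall fun x => ?_)
  · filter_upwards [hsmall] with δ hδ
    exact (((hζ.continuous_fderiv_apply ξ).measurable.mul
      ((contDiff_entropyFst hδ.1).continuous.measurable.comp (hmeas ξ))).add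
      ((hζ.continuous_fderiv_apply _).measurable.mul
        ((contDiff_entropySnd hδ.1).continuous.measurable.comp
          ((hmeas ξ).prodMk (hmeas (perp ξ)))))).aestronglyMeasurable
  · filter_upwards [hsmall] with δ ⟨hδ0, hδ1⟩
    refine .of_forall fun x => (norm_add_le _ _).trans ?_
    rw [norm_mul, norm_mul]
    gcongr
    · exact (abs_entropyFst_le hδ0 _).trans (by nlinarith)
    · exact (hsnd δ hδ0 x).trans hδ1
  · have hsnd_lim : Tendsto (fun δ => entropySnd δ (component ξ u x) (component (perp ξ) u x))
        (𝓝[>] 0) (𝓝 0) :=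
      squeeze_zero_norm' (eventually_mem_nhdsWithin.mono fun δ hδ => hsnd δ hδ x)
        nhdsWithin_le_nhds
    simpa only [mul_zero, add_zero] using
      ((tendsto_entropyFst _).const_mul (fderiv ℝ ζ x ξ)).add (hsnd_lim.const_mul _)

theorem kineticEquation (hu : IsUnitField u) (hΩ : IsOpen Ω) (hdiv : IsDivFree Ω u)
    (hcomm : CommutatorVanishes Ω u) : KineticEquation Ω u := by
  intro ξ ζ hζ
  have hunit : ∀ η : Plane, ‖η‖ = 1 → ∫ x, fderiv ℝ ζ x η * Real.sign (component η u x) = 0 :=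
    fun η hη => tendsto_nhds_unique (hu.tendsto_entropyPairing_component hη hζ) <|
      tendsto_const_nhds.congr' <| eventually_mem_nhdsWithin.mono fun _ hδ =>
        (hu.entropyPairing_component_eq_zero hΩ hdiv hcomm hη hδ hζ).symm
  rcases eq_or_ne ξ 0 with rfl | hξ
  · simp only [map_zero, zero_mul, integral_zero]
  · have hpos : 0 < ‖ξ‖ := norm_pos_iff.2 hξ
    have hscale : ∀ x, fderiv ℝ ζ x ξ * Real.sign (component ξ u x) =
        ‖ξ‖ * (fderiv ℝ ζ x (‖ξ‖⁻¹ • ξ) * Real.sign (component (‖ξ‖⁻¹ • ξ) u x)) := fun x => by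
      rw [component, component, real_inner_smul_left, sign_mul_of_pos (inv_pos.2 hpos), map_smul,
        smul_eq_mul, mul_assoc, mul_inv_cancel_left₀ hpos.ne']
    simp only [hscale, integral_const_mul,
      hunit (‖ξ‖⁻¹ • ξ) (norm_smul_inv_norm (𝕜 := ℝ) hξ), mul_zero]

end IsUnitField

end KineticEquation

section SignRule

theorem abs_sign_le_one (s : ℝ) : |Real.sign s| ≤ 1 := by
  rcases Real.sign_apply_eq s with h | h | h <;> norm_num [h]

theorem measurable_sign : Measurable Real.sign :=
  .ite measurableSet_Iio measurable_const
    (.ite measurableSet_Ioi measurable_const measurable_const)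

theorem abs_sign_sub_sign_le {c : ℝ} (hc : c ≠ 0) (s : ℝ) :
    |Real.sign s - Real.sign c| ≤ 2 / |c| * |s - c| := by
  have hcpos : 0 < |c| := abs_pos.2 hc
  rcases lt_or_ge 0 (s * c) with h | h
  · have heq : Real.sign s = Real.sign c := by
      rcases pos_and_pos_or_neg_and_neg_of_mul_pos h with ⟨hs, hc⟩ | ⟨hs, hc⟩
      · rw [Real.sign_of_pos hs, Real.sign_of_pos hc]
      · rw [Real.sign_of_neg hs, Real.sign_of_neg hc]
    rw [heq, sub_self, abs_zero]
    positivity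
  · have hle : |c| ≤ |s - c| := sq_le_sq.1 (by nlinarith [sq_nonneg s])
    calc |Real.sign s - Real.sign c| ≤ |Real.sign s| + |Real.sign c| := abs_sub _ _
      _ ≤ 1 + 1 := add_le_add (abs_sign_le_one s) (abs_sign_le_one c)
      _ = 2 / |c| * |c| := by rw [div_mul_cancel₀ _ hcpos.ne', one_add_one_eq_two]
      _ ≤ 2 / |c| * |s - c| := by gcongr

theorem eq_of_forall_mem_segment_fderiv_eq_zero {E F : Type*} [NormedAddCommGroup E]
    [NormedSpace ℝ E] [NormedAddCommGroup F] [NormedSpace ℝ F] {f : E → F} {x y : E}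
    (hf : ∀ z ∈ segment ℝ x y, DifferentiableAt ℝ f z)
    (hzero : ∀ z ∈ segment ℝ x y, fderiv ℝ f z (y - x) = 0) : f x = f y := by
  have hmem : ∀ t ∈ Set.Icc (0 : ℝ) 1, x + t • (y - x) ∈ segment ℝ x y := fun t ht =>
    segment_eq_image' ℝ x y ▸ Set.mem_image_of_mem _ ht
  have hderiv : ∀ t ∈ Set.Icc (0 : ℝ) 1, HasDerivAt (fun t : ℝ => f (x + t • (y - x))) 0 t :=
    fun t ht => by
      have hline : HasDerivAt (fun t : ℝ => x + t • (y - x)) (y - x) t := by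
        simpa using ((hasDerivAt_id t).smul_const (y - x)).const_add x
      rw [← hzero _ (hmem t ht)]
      exact (hf _ (hmem t ht)).hasFDerivAt.comp_hasDerivAt t hline
  have hconst := constant_of_has_deriv_right_zero
    (fun t ht => (hderiv t ht).continuousAt.continuousWithinAt)
    (fun t ht => (hderiv t (Set.Ico_subset_Icc_self ht)).hasDerivWithinAt) 1
    (Set.right_mem_Icc.2 zero_le_one)
  simpa using hconst.symm

variable {Ω : Set Plane} {u : Plane → Plane} {ξ x y : Plane} {ρ : Plane → ℝ} {C ε : ℝ}

namespace IsUnitField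

theorem locallyIntegrable_sign_component (hu : IsUnitField u) (ξ : Plane) :
    LocallyIntegrable fun y => Real.sign (component ξ u y) :=
  locallyIntegrable_of_abs_le (measurable_sign.comp (hu.measurable_component ξ))
    fun _ => abs_sign_le_one _

theorem isLebesguePoint_sign_component (hu : IsUnitField u) (hx : IsLebesguePoint u x)
    (hξ : component ξ u x ≠ 0) : IsLebesguePoint (fun y => Real.sign (component ξ u y)) x :=
  (hu.isLebesguePoint_component hx ξ).of_norm_sub_le (hu.locallyIntegrable_component ξ)
    fun _ => abs_sign_sub_sign_le hξ _

end IsUnitField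

namespace KineticEquation

theorem fderiv_mollify_sign_component_eq_zero (hkin : KineticEquation Ω u) (hu : IsUnitField u)
    (h : IsMollifier C ε ρ) (hx : closedBall x ε ⊆ Ω) :
    fderiv ℝ (mollify ρ fun y => Real.sign (component ξ u y)) x ξ = 0 := by
  have htest := hkin ξ (h.isTestFunction hx)
  simp only [h.fderiv_comp_sub, neg_mul, integral_neg, neg_eq_zero] at htest
  rw [h.fderiv_mollify (hu.locallyIntegrable_sign_component ξ), ← htest]
  simp only [mul_comm]

theorem sign_component_eq (hkin : KineticEquation Ω u) (hu : IsUnitField u) (hΩ : IsOpen Ω)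
    (hx : IsLebesguePoint u x) (hy : IsLebesguePoint u y) (hseg : segment ℝ x y ⊆ Ω)
    (hcx : component (y - x) u x ≠ 0) (hcy : component (y - x) u y ≠ 0) :
    Real.sign (component (y - x) u x) = Real.sign (component (y - x) u y) := by
  obtain ⟨C, ε, ρ, hρ⟩ := exists_isApproximateIdentity Plane
  have hint := hu.locallyIntegrable_sign_component (y - x)
  have hcompact : IsCompact (segment ℝ x y) := by
    rw [segment_eq_image_lineMap]
    exact isCompact_Icc.image AffineMap.lineMap_continuous
  obtain ⟨τ, hτ, hball⟩ := exists_pos_forall_closedBall_subset hΩ hcompact hseg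
  have heq : ∀ᶠ n in atTop, mollify (ρ n) (fun z => Real.sign (component (y - x) u z)) x =
      mollify (ρ n) (fun z => Real.sign (component (y - x) u z)) y := by
    filter_upwards [hρ.tendsto_zero.eventually (gt_mem_nhds hτ)] with n hn
    exact eq_of_forall_mem_segment_fderiv_eq_zero
      (fun z _ => ((hρ.isMollifier n).contDiff_mollify hint).differentiable (by simp) z)
      fun z hz => hkin.fderiv_mollify_sign_component_eq_zero hu (hρ.isMollifier n)
        (hball _ hn z hz)
  exact tendsto_nhds_unique
    ((hρ.tendsto_mollify hint (hu.isLebesguePoint_sign_component hx hcx)).congr' heq)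
    (hρ.tendsto_mollify hint (hu.isLebesguePoint_sign_component hy hcy))

theorem inner_mul_inner_nonneg (hkin : KineticEquation Ω u) (hu : IsUnitField u) (hΩ : IsOpen Ω)
    (hx : IsLebesguePoint u x) (hy : IsLebesguePoint u y) (hseg : segment ℝ x y ⊆ Ω) :
    0 ≤ ⟪u x, y - x⟫ * ⟪u y, y - x⟫ := by
  rw [real_inner_comm, real_inner_comm (y - x)]
  change 0 ≤ component (y - x) u x * component (y - x) u y
  by_contra! hneg
  have hsign := hkin.sign_component_eq hu hΩ hx hy hseg (left_ne_zero_of_mul hneg.ne)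
    (right_ne_zero_of_mul hneg.ne)
  rcases mul_neg_iff.1 hneg with ⟨hpos, hneg⟩ | ⟨hneg, hpos⟩ <;>
    norm_num [Real.sign_of_pos hpos, Real.sign_of_neg hneg] at hsign

end KineticEquation

end SignRule

section ClusterValues

theorem exists_mem_closedBall_le_setAverage {E : Type*} [NormedAddCommGroup E]
    [MeasureSpace E] [NormedSpace ℝ E] [FiniteDimensional ℝ E] [BorelSpace E]
    [(volume : Measure E).IsAddHaarMeasure] {g : E → ℝ} {D : Set E} {δ : ℝ}
    (hg : LocallyIntegrable g) (hD : ∀ᵐ y, y ∈ D) (w : E) (hδ : 0 < δ) :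
    ∃ z ∈ closedBall w δ, z ∈ D ∧ g z ≤ ⨍ y in closedBall w δ, g y := by
  have hvol : volume.restrict (closedBall w δ) ≠ 0 := by
    rw [Ne, Measure.restrict_eq_zero]
    exact (measure_closedBall_pos volume w hδ).ne'
  have hfin : IsFiniteMeasure (volume.restrict (closedBall w δ)) :=
    isFiniteMeasure_restrict.2 measure_closedBall_lt_top.ne
  have hnull : volume.restrict (closedBall w δ) (D ∩ closedBall w δ)ᶜ = 0 :=
    mem_ae_iff.1 (inter_mem (ae_restrict_of_ae hD) (ae_restrict_mem measurableSet_closedBall))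
  obtain ⟨z, hz, hle⟩ := exists_notMem_null_le_average hvol
    (hg.integrableOn_isCompact (isCompact_closedBall w δ)) hnull
  rw [Set.notMem_compl_iff] at hz
  exact ⟨z, hz.2, hz.1, hle⟩

theorem inner_sub_pos_of_mem_closedBall {E : Type*} [NormedAddCommGroup E]
    [InnerProductSpace ℝ E] {e x z : E} {δ : ℝ} (he : e ≠ 0) (hδ : 0 < δ)
    (hz : z ∈ closedBall (x + (3 / 2 * δ / ‖e‖) • e) δ) : 0 < ⟪e, z - x⟫ := by
  have hpos : 0 < ‖e‖ := norm_pos_iff.2 he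
  have hsplit : ⟪e, z - x⟫ =
      3 / 2 * δ * ‖e‖ + ⟪e, z - (x + (3 / 2 * δ / ‖e‖) • e)⟫ := by
    rw [← sub_sub, inner_sub_right e (z - x), real_inner_smul_right, real_inner_self_eq_norm_sq]
    field_simp
    ring
  have hle := (abs_real_inner_le_norm e _).trans
    (mul_le_mul_of_nonneg_left (mem_closedBall_iff_norm.1 hz) hpos.le)
  nlinarith [(abs_le.1 hle).1, mul_pos hδ hpos]

theorem IsLebesguePoint.mapClusterPt {E F : Type*} [NormedAddCommGroup E] [InnerProductSpace ℝ E]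
    [FiniteDimensional ℝ E] [MeasurableSpace E] [BorelSpace E] [NormedAddCommGroup F] {f : E → F}
    {Ω D : Set E} {x e : E} (hx : IsLebesguePoint f x) (hf : LocallyIntegrable f) (hΩ : Ω ∈ 𝓝 x)
    (hD : ∀ᵐ y, y ∈ D) (he : e ≠ 0) :
    MapClusterPt (f x) (𝓝[Ω ∩ D ∩ {z | 0 < ⟪e, z - x⟫}] x) f := by
  set δ : ℕ → ℝ := fun n => 1 / (n + 1)
  have hδ : ∀ n, 0 < δ n := fun n => Nat.one_div_pos_of_nat
  have hδ0 : Tendsto δ atTop (𝓝 0) := tendsto_one_div_add_atTop_nhds_zero_nat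
  set w : ℕ → E := fun n => x + (3 / 2 * δ n / ‖e‖) • e
  have hw : ∀ n, dist (w n) x = 3 / 2 * δ n := fun n => by
    have := hδ n
    rw [dist_eq_norm, add_sub_cancel_left, norm_smul, Real.norm_of_nonneg (by positivity),
      div_mul_cancel₀ _ (norm_ne_zero_iff.2 he)]
  choose z hzw hzD hz using fun n => exists_mem_closedBall_le_setAverage
    (g := fun y => ‖f y - f x‖) (fun y => ((hf.sub (locallyIntegrable_const (f x))) y).norm) hD
    (w n) (hδ n)
  have hzx : Tendsto z atTop (𝓝 x) := by
    refine tendsto_iff_dist_tendsto_zero.2 (squeeze_zero (fun n => dist_nonneg) (fun n => ?_)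
      (by simpa using hδ0.const_mul (5 / 2)))
    linarith [dist_triangle (z n) (w n) x, mem_closedBall.1 (hzw n), hw n]
  have hfz : Tendsto (fun n => f (z n)) atTop (𝓝 (f x)) :=
    tendsto_iff_norm_sub_tendsto_zero.2 <| squeeze_zero (fun n => norm_nonneg _) hz <|
      hx w δ (tendsto_nhdsWithin_iff.2 ⟨hδ0, .of_forall hδ⟩) (.of_forall fun n => by
        rw [mem_closedBall, dist_comm, hw]
        linarith [hδ n])
  refine MapClusterPt.of_comp (tendsto_nhdsWithin_iff.2 ⟨hzx, ?_⟩) hfz.mapClusterPt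
  filter_upwards [hzx.eventually hΩ] with n hn
  exact ⟨⟨hn, hzD n⟩, inner_sub_pos_of_mem_closedBall he (hδ n) (hzw n)⟩

theorem KineticEquation.isCharacteristicField {Ω : Set Plane} {u : Plane → Plane}
    (hkin : KineticEquation Ω u) (hu : IsUnitField u) (hΩ : IsOpen Ω) :
    IsCharacteristicField Ω (Ω ∩ {x | IsLebesguePoint u x}) u where
  isOpen := hΩ
  subset := Set.inter_subset_left
  dense :=
    (Measure.dense_of_ae (ae_isLebesguePoint hu.locallyIntegrable)).open_subset_closure_inter hΩ
  norm_eq_one x _ := hu.norm_eq_one x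
  sign _ hx _ hy hseg := hkin.inner_mul_inner_nonneg hu hΩ hx.2 hy.2 hseg
  cluster _ hx _ he := hx.2.mapClusterPt hu.locallyIntegrable (hΩ.mem_nhds hx.1)
    (ae_isLebesguePoint hu.locallyIntegrable) he

end ClusterValues

section Representative

variable {Ω K : Set Plane} {u v : Plane → Plane} {p : ℝ}

theorem IsDivFree.congr (h : IsDivFree Ω u) (huv : v =ᵐ[volume.restrict Ω] u) :
    IsDivFree Ω v := by
  intro φ hφ
  rw [← h φ hφ]
  exact integral_congr_ae (huv.mono fun x hx => by simp only [hx])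

theorem IsWeakDeriv.congr {G : Plane → Plane →L[ℝ] Plane} (h : IsWeakDeriv Ω u G)
    (huv : v =ᵐ[volume.restrict Ω] u) : IsWeakDeriv Ω v G := by
  intro φ hφ e
  rw [← h φ hφ e]
  exact integral_congr_ae (huv.mono fun x hx => by simp only [hx])

theorem lintegral_gagliardoKernel_congr (huv : v =ᵐ[volume.restrict K] u) :
    ∫⁻ x in K, ∫⁻ y in K, gagliardoKernel p v x y =
      ∫⁻ x in K, ∫⁻ y in K, gagliardoKernel p u x y :=
  lintegral_congr_ae <| huv.mono fun x hx => lintegral_congr_ae <| huv.mono fun y hy => by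
    simp only [gagliardoKernel, hx, hy]

theorem MemLpLoc.integrableOn {F : Type*} [NormedAddCommGroup F] {f : Plane → F}
    (h : MemLpLoc p Ω f) (hp : 1 ≤ p) (hK : IsCompact K) (hKΩ : K ⊆ Ω) : IntegrableOn f K := by
  have : IsFiniteMeasure (volume.restrict K) := isFiniteMeasure_restrict.2 hK.measure_lt_top.ne
  exact (h K hK hKΩ).integrable (by simpa using ENNReal.ofReal_le_ofReal hp)

theorem MemLpLoc.aestronglyMeasurable (h : MemLpLoc p Ω u) (hp : 1 ≤ p) (hΩ : IsOpen Ω) :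
    AEStronglyMeasurable u (volume.restrict Ω) :=
  ((locallyIntegrableOn_iff hΩ.isLocallyClosed).2
    fun _ hKΩ hK => h.integrableOn hp hK hKΩ).aestronglyMeasurable

theorem exists_isUnitField_ae_eq {μ : Measure Plane} (hu : AEStronglyMeasurable u μ)
    (hu1 : ∀ᵐ x ∂μ, ‖u x‖ = 1) : ∃ v, IsUnitField v ∧ v =ᵐ[μ] u := by
  classical
  have hmeas : Measurable (hu.mk u) := hu.stronglyMeasurable_mk.measurable
  refine ⟨fun x => if ‖hu.mk u x‖ = 1 then hu.mk u x else EuclideanSpace.single 0 1, ⟨?_, ?_⟩, ?_⟩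
  · exact .ite (measurableSet_eq_fun hmeas.norm measurable_const) hmeas measurable_const
  · intro x
    split_ifs with hx
    · exact hx
    · simp
  · filter_upwards [hu.ae_eq_mk, hu1] with x hx hx1
    rw [hx] at hx1
    rw [if_pos hx1, hx]

theorem IsUnitField.commutatorVanishes_of_memSobolevLoc (hv : IsUnitField v) (hΩ : IsOpen Ω)
    (hp : p ∈ Set.Icc 1 3) (hu : MemSobolevLoc (1 / p) p Ω u)
    (huv : v =ᵐ[volume.restrict Ω] u) : CommutatorVanishes Ω v := by
  rcases hu.2 with ⟨-, G, hGint, hG⟩ | ⟨-, -, hfin⟩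
  · exact hv.commutatorVanishes_of_isWeakDeriv hΩ (hG.congr huv)
      fun K hK hKΩ => hGint.integrableOn hp.1 hK hKΩ
  · refine hv.commutatorVanishes_of_gagliardo hΩ hp fun K hK hKΩ => ?_
    have hexp : 2 + 1 / p * p = 3 := by
      rw [one_div_mul_cancel (by linarith [hp.1])]
      norm_num
    rw [lintegral_gagliardoKernel_congr (ae_restrict_of_ae_restrict_of_subset hKΩ huv)]
    simpa only [gagliardoKernel, hexp] using hfin K hK hKΩ

end Representative

theorem theorem1 (Ω : Set Plane) (hΩ : IsOpen Ω) (p : ℝ) (hp : p ∈ Set.Icc (1 : ℝ) 3)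
    (u : Plane → Plane) (hu : MemSobolevDiv (1 / p) p Ω u) :
    ∃ (v : Plane → Plane) (S : Set Plane),
      v =ᵐ[volume.restrict Ω] u ∧
      S ⊆ Ω ∧
      (∀ x ∈ Ω, ∃ V ∈ 𝓝 x, (V ∩ S).Finite) ∧
      LocallyLipschitzOn (Ω \ S) v ∧
      ∀ P ∈ S, ∃ α : ℝ, (α = 1 ∨ α = -1) ∧
        ∀ U : Set Plane, U ∈ 𝓝 P → Convex ℝ U → U ⊆ Ω →
          ∀ x ∈ U, x ≠ P → v x = (α / ‖x - P‖) • perp (x - P) := by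
  obtain ⟨w, hw, hwu⟩ :=
    exists_isUnitField_ae_eq (hu.sobolev.1.aestronglyMeasurable hp.1 hΩ) hu.unit_length
  have hcomm := hw.commutatorVanishes_of_memSobolevLoc hΩ hp hu.sobolev hwu
  have hkin := hw.kineticEquation hΩ (hu.div_free.congr hwu) hcomm
  have H := hkin.isCharacteristicField hw hΩ
  set D := Ω ∩ {x | IsLebesguePoint w x}
  refine ⟨extendFrom D w, vortexSet Ω D w, ?_, fun P hP => hP.1,
    fun x hx => H.exists_finite_inter_vortexSet hx, H.locallyLipschitzOn_extendFrom, fun P hP => ?_⟩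
  · filter_upwards [hwu, ae_restrict_mem hΩ.measurableSet,
      ae_restrict_of_ae (ae_isLebesguePoint hw.locallyIntegrable)] with x hxu hxΩ hx
    rw [H.eqOn_extendFrom ⟨hxΩ, hx⟩, hxu]
  · obtain ⟨α, hα, hvortex⟩ := H.eqOn_extendFrom_vortex hP
    exact ⟨α, hα, fun U hU hc hUΩ x hx hxP => hvortex U hU hc hUΩ ⟨hx, hxP⟩⟩
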